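/- Consider the Gaussian Y-channel: three full-duplex users communicate via a relay, with real channel gains $h_1,h_2,h_3$ satisfying $h_1^2\ge h_2^2\ge h_3^2$. For each ordered pair $(j,k)$ of distinct users, user $j$ has a message $m_{jk}$ for user $k$, uniform on $\{1,\dots,\lfloor 2^{nR_{jk}}\rfloor\}$; the six messages are independent. At time $i\in\{1,\dots,n\}$ the relay receives $y_{ri}=h_1x_{1i}+h_2x_{2i}+h_3x_{3i}+z_{ri}$ and user $j$ receives $y_{ji}=h_jx_{ri}+z_{ji}$, where all noise variables are i.i.d. $\mathcal N(0,1)$ and independent of the messages. The encoding is non-restricted: for distinct $j,k,l$, $x_{ji}$ is a (measurable) function of $(m_{jk},m_{jl},y_j^{i-1})$, and $x_{ri}$ is a function of $y_r^{i-1}$; each of $X_1,X_2,X_3,X_r$ satisfies $\frac1n\sum_{i=1}^n\mathbb E[X_i^2]\le P$. After time $n$, user $j$ decodes $(m_{kj},m_{lj})$ from $(y_j^n,m_{jk},m_{jl})$. A tuple of six rates $R_{jk}\ge0$ is achievable if there is a sequence of such codes of lengths $n$ whose average probability that some user makes a decoding error tends to $0$ as $n\to\infty$. The sum-capacity $C_N(P)$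 is the supremum of $R_\Sigma=\sum_{j\ne k}R_{jk}$ over all achievable tuples. Let $C(x)=\frac12\log_2(1+x)$. (1) For every $P\ge 0$, $$C_N(P)\le C\big((h_2^2+h_3^2)P\big)+C\big(\min\{h_1^2+h_3^2,\,(|h_2|+|h_3|)^2\}P\big).$$ (2) The degrees of freedom (DoF) are at most $2$: $\limsup_{P\to\infty}\frac{C_N(P)}{\frac12\log_2P}\le2$; in particular, if the limit $d=\lim_{P\to\infty}\frac{C_N(P)}{\frac12\log_2P}$ exists, then $d\le2$. (3) Suppose $h_3\ne0$. The cut-set bound then has DoF $3$ and is not asymptotically achievable. Precisely, let $\overline C_{CS}(P)=C(\min\{h_1^2,h_2^2+h_3^2\}P)+C(h_2^2P)+C(h_3^2P)$, and let $\overline C_{LP}(P)$ be the supremum of $R_\Sigma$ over all nonnegative rate tuples that satisfy the cut-set bounds $$R_{jk}+R_{jl}\le C\big(\min\{h_j^2,h_k^2+h_l^2\}P\big),\qquad R_{jl}+R_{kl}\le C\big(\min\{(|h_j|+|h_k|)^2,h_l^2\}P\big)$$ for all distinct $j,k,l\in\{1,2,3\}$. For $\overline C=\overline C_{CS}$ and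 for $\overline C=\overline C_{LP}$, $$\lim_{P\to\infty}\frac{\overline C(P)}{\frac12\log_2P}=3\qquad\text{and}\qquad \lim_{P\to\infty}\big(\overline C(P)-C_N(P)\big)=\infty .$$ -/

import Mathlib

open MeasureTheory ProbabilityTheory Filter Topology

noncomputable section

namespace YChannel

/-- The four nodes: `some j` is user `j` (the users `1, 2, 3` are `0, 1, 2 : Fin 3`), `none` is
the relay. -/
abbrev Node : Type := Option (Fin 3)

/-- Ordered pairs `(j, k)` of distinct users; they index the six messages `m_{jk}` (from `j` to
`k`) and the six rates `R_{jk}`. -/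
abbrev Link : Type := {p : Fin 3 × Fin 3 // p.1 ≠ p.2}

/-- A rate tuple. -/
abbrev Rates : Type := Link → ℝ

/-- The sum `R_Σ` of the six rates. -/
def sumRate (R : Rates) : ℝ := ∑ p, R p

/-- Sizes of the message sets: `M_{jk} = {1, …, 2^{n R_{jk}}}`, that is `⌊2^{n R_{jk}}⌋` messages. -/
def messageCount (R : Rates) (n : ℕ) : Link → ℕ := fun p => ⌊(2 : ℝ) ^ ((n : ℝ) * R p)⌋₊

/-- The vector of all six messages. -/
abbrev Messages (M : Link → ℕ) : Type := (p : Link) → Fin (M p)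

/-- The two messages originating at user `j`. -/
abbrev OwnMessages (M : Link → ℕ) (j : Fin 3) : Type :=
  (p : {p : Link // p.1.1 = j}) → Fin (M p.1)

/-- The two messages intended for user `j`. -/
abbrev DesiredMessages (M : Link → ℕ) (j : Fin 3) : Type :=
  (p : {p : Link // p.1.2 = j}) → Fin (M p.1)

/-- The messages originating at user `j`, out of all the messages. -/
def own {M : Link → ℕ} (m : Messages M) (j : Fin 3) : OwnMessages M j := fun p => m p.1

/-- The messages intended for user `j`, out of all the messages. -/
def desired {M : Link → ℕ} (m : Messages M) (j : Fin 3) : DesiredMessages M j := fun p => m p.1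

/-- A code of length `n` for the Y-channel with non-restricted encoding. At time `i` user `j` sends
a function of its own two messages and of the symbols it received at the times before `i`; the
relay sends a function of the symbols it received at the times before `i`; after time `n`, user `j`
decodes the messages intended for it from all its received symbols and its own messages. -/
structure Code (M : Link → ℕ) (n : ℕ) where
  encode : (j : Fin 3) → (i : Fin n) → OwnMessages M j → (Fin i → ℝ) → ℝ
  measurable_encode : ∀ j i w, Measurable (encode j i w)
  relay : (i : Fin n) → (Fin i → ℝ) → ℝ
  measurable_relay : ∀ i, Measurable (relay i)
  decode : (j : Fin 3) → (Fin n → ℝ) → OwnMessages M j → DesiredMessages M j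
  measurable_decode : ∀ j w, Measurable fun y => decode j y w

/-- Noise realizations: `z v i` is the noise at the receiver of node `v` at time `i`. -/
abbrev Noise (n : ℕ) : Type := Node → Fin n → ℝ

/-- The joint law of messages and noise: the six messages are independent and uniform, all noise
variables are independent standard Gaussians, and messages and noise are independent. -/
def law (M : Link → ℕ) (n : ℕ) : Measure (Messages M × Noise n) :=
  (uniformOn (Set.univ : Set (Messages M))).prod
    (Measure.pi fun _ : Node => Measure.pi fun _ : Fin n => gaussianReal 0 1)

variable {M : Link → ℕ} {n : ℕ}

/-- The symbol received by a node at time `i`, for channel gains `h`: the relay receives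
`∑ j, h j * x_{j i} + z_{r i}`, and user `j` receives `h j * x_{r i} + z_{j i}`. -/
def Code.received (c : Code M n) (h : Fin 3 → ℝ) (m : Messages M) (z : Noise n) (i : Fin n) :
    Node → ℝ
  | none => (∑ j, h j * c.encode j i (own m j)
      fun s => c.received h m z ⟨s, s.2.trans i.2⟩ (some j)) + z none i
  | some j => h j * c.relay i (fun s => c.received h m z ⟨s, s.2.trans i.2⟩ none) + z (some j) i
termination_by i.val
decreasing_by all_goals exact s.2

/-- The symbol sent by user `j` at time `i`. -/
def Code.userInput (c : Code M n) (h : Fin 3 → ℝ) (j : Fin 3) (i : Fin n)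
    (ω : Messages M × Noise n) : ℝ :=
  c.encode j i (own ω.1 j) fun s => c.received h ω.1 ω.2 ⟨s, s.2.trans i.2⟩ (some j)

/-- The symbol sent by the relay at time `i`. -/
def Code.relayInput (c : Code M n) (h : Fin 3 → ℝ) (i : Fin n) (ω : Messages M × Noise n) : ℝ :=
  c.relay i fun s => c.received h ω.1 ω.2 ⟨s, s.2.trans i.2⟩ none

theorem Code.received_relay (c : Code M n) (h : Fin 3 → ℝ) (ω : Messages M × Noise n)
    (i : Fin n) :
    c.received h ω.1 ω.2 i none = (∑ j, h j * c.userInput h j i ω) + ω.2 none i := by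
  rw [Code.received]; rfl

theorem Code.received_user (c : Code M n) (h : Fin 3 → ℝ) (ω : Messages M × Noise n)
    (i : Fin n) (j : Fin 3) :
    c.received h ω.1 ω.2 i (some j) = h j * c.relayInput h i ω + ω.2 (some j) i := by
  rw [Code.received]; rfl

/-- A sequence of random inputs has average power at most `P`: `(1/n) ∑ E[X_i²] ≤ P`. -/
def PowerBound (X : Fin n → Messages M × Noise n → ℝ) (P : ℝ) : Prop :=
  (∀ i, MemLp (X i) 2 (law M n)) ∧ ∑ i, ∫ ω, X i ω ^ 2 ∂law M n ≤ n * P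

/-- The power constraint `P` at the three users and at the relay. -/
def Code.PowerConstraint (c : Code M n) (h : Fin 3 → ℝ) (P : ℝ) : Prop :=
  (∀ j, PowerBound (c.userInput h j) P) ∧ PowerBound (c.relayInput h) P

/-- The probability that some user decodes some message intended for it wrongly, averaged over the
messages. -/
def Code.errorProb (c : Code M n) (h : Fin 3 → ℝ) : ℝ :=
  (law M n).real {ω | ∃ j, c.decode j (fun i => c.received h ω.1 ω.2 i (some j)) (own ω.1 j) ≠
    desired ω.1 j}

/-- The capacity region of the non-restricted Y-channel with gains `h` and power `P`: the set of
achievable rate tuples. -/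
def capacityRegion (h : Fin 3 → ℝ) (P : ℝ) : Set Rates :=
  {R | (∀ p, 0 ≤ R p) ∧ ∃ c : (n : ℕ) → Code (messageCount R n) n,
    (∀ n, (c n).PowerConstraint h P) ∧ Tendsto (fun n => (c n).errorProb h) atTop (𝓝 0)}

/-- The sum-capacity `C_N` of the non-restricted Y-channel, as an extended real. -/
def sumCapacity (h : Fin 3 → ℝ) (P : ℝ) : EReal :=
  ⨆ R ∈ capacityRegion h P, (sumRate R : EReal)

/-- `C(x) = (1/2) log₂ (1 + x)`. -/
def cap (x : ℝ) : ℝ := 1 / 2 * Real.logb 2 (1 + x)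

/-- The ratio `S(P) / ((1/2) log₂ P)`, for a sum-rate `S` that depends on the power `P` (which is
the signal-to-noise ratio, the noise having unit variance). -/
def dofRatio (S : ℝ → EReal) (P : ℝ) : EReal := S P / ((1 / 2 * Real.logb 2 P : ℝ) : EReal)

/-- `S` has `d` degrees of freedom: `d = lim_{P → ∞} S(P) / ((1/2) log₂ P)`. -/
def HasDoF (S : ℝ → EReal) (d : EReal) : Prop := Tendsto (dofRatio S) atTop (𝓝 d)

/-- The Gaussian cut-set outer region: the nonnegative rate tuples that satisfy, for all distinct
users `j, k, l`, the two cut-set bounds on `R_{jk} + R_{jl}` and on `R_{jl} + R_{kl}`. -/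
def cutSetRegion (h : Fin 3 → ℝ) (P : ℝ) : Set Rates :=
  {R | (∀ p, 0 ≤ R p) ∧ ∀ (j k l : Fin 3) (hjk : j ≠ k) (hjl : j ≠ l) (hkl : k ≠ l),
    R ⟨(j, k), hjk⟩ + R ⟨(j, l), hjl⟩ ≤ cap (min (h j ^ 2) (h k ^ 2 + h l ^ 2) * P) ∧
    R ⟨(j, l), hjl⟩ + R ⟨(k, l), hkl⟩ ≤ cap (min ((|h j| + |h k|) ^ 2) (h l ^ 2) * P)}

/-- The largest sum-rate that the cut-set bounds allow. -/
def cutSetSumRate (h : Fin 3 → ℝ) (P : ℝ) : EReal :=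
  ⨆ R ∈ cutSetRegion h P, (sumRate R : EReal)

/-- The closed-form cut-set bound on the sum-capacity (for `h 0 ^ 2 ≥ h 1 ^ 2 ≥ h 2 ^ 2`), obtained
by adding the cut-set bounds on the outgoing rates of the three users. -/
def cutSetBound (h : Fin 3 → ℝ) (P : ℝ) : ℝ :=
  cap (min (h 0 ^ 2) (h 1 ^ 2 + h 2 ^ 2) * P) + cap (h 1 ^ 2 * P) + cap (h 2 ^ 2 * P)

end YChannel

end

noncomputable section

namespace YChannel

/-! The bound is a genie argument. Fix users `j`, `l` and let `k` be the third. Give a receiver the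
outputs of `j` and `l` together with the messages `m_jk`, `m_jl`, `m_lk`. It knows all that `j`
sends, so it decodes as `j` and learns `m_kj`, `m_lj`. Now it also knows both messages of `l`,
decodes as `l`, and learns `m_kl`. Hence three rates together are limited by one scalar Gaussian
channel with feedback. On the downlink, combining the two outputs gives gain `h j ^ 2 + h l ^ 2`. On
the uplink, handing over all user noises leaves the relay output with the contribution of `j`
removed, of gain at most `(|h k| + |h l|) ^ 2`. The triples for `(j, l) = (1, 2)` and `(0, 2)`
partition the six messages (`sumRate_eq_genieLinks`), so two such bounds control the sum rate.

The scalar converse (`measureReal_mul_log_le`) uses a change of measure instead of entropies. The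
output is compared with i.i.d. `N(0, 1 + Q)`. The expected log-likelihood ratio is at most `n / 2 *
log (1 + Q)`, because a causal input is uncorrelated with the present noise. Under the reference law
the output sets of different messages with equal side information are disjoint, so correct decoding
has weight at most `|S| / |W|`. Feedback is harmless because the map from noise to output is
triangular with unit diagonal and preserves Lebesgue measure (`measurePreserving_causal_shift`).

Asymptotically the sum-capacity is at most two capacities `cap (K * P)`, while the cut-set bounds
allow at least three `cap (h 2 ^ 2 * P)`. Capacities with different positive gains differ by a
bounded amount, so the gap grows like one capacity. -/

/-! ### Product densities and causal shifts of Gaussian noise -/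

theorem lintegral_pi_prod {n : ℕ} (μ : Fin n → Measure ℝ) [∀ i, SigmaFinite (μ i)]
    (f : Fin n → ℝ → ENNReal) (hf : ∀ i, Measurable (f i)) :
    ∫⁻ x, ∏ i, f i (x i) ∂Measure.pi μ = ∏ i, ∫⁻ t, f i t ∂μ i := by
  induction n with
  | zero => simp
  | succ n ih =>
    rw [← ((measurePreserving_piFinSuccAbove μ 0).symm).lintegral_comp_emb
      (MeasurableEquiv.measurableEmbedding _), Fin.prod_univ_succ]
    simp only [Fin.prod_univ_succ, MeasurableEquiv.piFinSuccAbove_symm_apply, Fin.insertNthEquiv_zero,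
      Fin.consEquiv_apply, Fin.cons_zero, Fin.cons_succ, Fin.succAbove_zero]
    rw [lintegral_prod_mul (f := f 0) (g := fun y : Fin n → ℝ => ∏ i : Fin n, f i.succ (y i))
      (hf 0).aemeasurable]
    · rw [ih (fun i => μ i.succ) _ (fun i => hf i.succ)]
    · exact (Finset.measurable_prod _ fun i _ =>
        (hf i.succ).comp (measurable_pi_apply i)).aemeasurable

theorem pi_withDensity {n : ℕ} (μ : Fin n → Measure ℝ) [∀ i, SigmaFinite (μ i)]
    (f : Fin n → ℝ → ENNReal) (hf : ∀ i, Measurable (f i))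
    [∀ i, SigmaFinite ((μ i).withDensity (f i))] :
    Measure.pi (fun i => (μ i).withDensity (f i)) =
      (Measure.pi μ).withDensity fun x => ∏ i, f i (x i) := by
  refine Measure.pi_eq fun s hs => ?_
  rw [withDensity_apply _ (MeasurableSet.univ_pi hs), ← lintegral_indicator (MeasurableSet.univ_pi hs)]
  have : (Set.univ.pi s).indicator (fun x => ∏ i, f i (x i)) =
      fun x => ∏ i, (s i).indicator (f i) (x i) := by
    ext x
    by_cases hx : x ∈ Set.univ.pi s
    · rw [Set.indicator_of_mem hx]
      exact Finset.prod_congr rfl fun i _ => (Set.indicator_of_mem (hx i trivial) _).symm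
    · rw [Set.indicator_of_notMem hx]
      simp only [Set.mem_pi, Set.mem_univ, true_implies, not_forall] at hx
      obtain ⟨i, hi⟩ := hx
      exact (Finset.prod_eq_zero (Finset.mem_univ i) (Set.indicator_of_notMem hi _)).symm
  rw [this, lintegral_pi_prod μ _ fun i => (hf i).indicator (hs i)]
  exact Finset.prod_congr rfl fun i _ => by
    rw [lintegral_indicator (hs i), withDensity_apply _ (hs i)]

/-- The map is triangular with unit diagonal. Peeling off the last coordinate makes it a skew
product: a causal shift of the first `n` coordinates, and over each point a translation of the last
one. No smoothness of `φ` is needed. -/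
theorem measurePreserving_causal_shift {n : ℕ} (φ : Fin n → (Fin n → ℝ) → ℝ)
    (hφ : ∀ i, Measurable (φ i))
    (hc : ∀ i z z', (∀ s < i, z s = z' s) → φ i z = φ i z') :
    MeasurePreserving (fun (z : Fin n → ℝ) i => φ i z + z i) volume volume := by
  induction n with
  | zero =>
    convert MeasurePreserving.id (volume : Measure (Fin 0 → ℝ)) using 1
  | succ n ih =>
    let e := MeasurableEquiv.piFinSuccAbove (fun _ : Fin (n + 1) => ℝ) (Fin.last n)
    have he : MeasurePreserving e volume volume :=
      volume_preserving_piFinSuccAbove (fun _ => ℝ) (Fin.last n)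
    -- The last coordinate gets the dummy value `0`; by causality no `φ i` depends on it.
    have hm : Measurable fun w : Fin n → ℝ => e.symm (0, w) :=
      e.symm.measurable.comp (measurable_const.prodMk measurable_id)
    have h1 := ih (fun i w => φ i.castSucc (e.symm (0, w))) (fun i => (hφ _).comp hm) (by
      intro i w w' hw
      refine hc _ _ _ fun s hs => ?_
      obtain ⟨s, rfl⟩ : ∃ t : Fin n, s = t.castSucc :=
        ⟨s.castLT (lt_of_lt_of_le hs (Nat.le_of_lt_succ i.castSucc.2)), by ext; simp⟩
      simpa [e] using hw s (by simpa using hs))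
    have h2 := h1.skew_product (μc := (volume : Measure ℝ)) (μd := volume)
      (g := fun w t => φ (Fin.last n) (e.symm (0, w)) + t)
      ((((hφ _).comp hm).comp measurable_fst).add measurable_snd)
      (Eventually.of_forall fun w => map_add_left_eq_self volume _)
    have h3 := (Measure.measurePreserving_swap.comp h2).comp
      (Measure.measurePreserving_swap (μ := (volume : Measure ℝ))
        (ν := (volume : Measure (Fin n → ℝ))))
    have h4 := (he.symm.comp h3).comp he
    convert h4 using 1
    ext z i
    have key : ∀ s : Fin (n + 1), s ≤ Fin.last n → ∀ t < s,
        z t = e.symm (0, (e z).2) t := by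
      intro s hs t ht
      obtain ⟨t, rfl⟩ : ∃ r : Fin n, t = r.castSucc :=
        ⟨t.castLT (lt_of_lt_of_le ht hs), by ext; simp⟩
      simp [e, Fin.init]
    induction i using Fin.lastCases with
    | last =>
      simp only [Function.comp_apply]
      rw [hc _ z _ (key (Fin.last n) le_rfl)]
      simp [e]
    | cast i =>
      simp only [Function.comp_apply]
      rw [hc _ z _ (key i.castSucc (Fin.le_last _))]
      simp [e, Fin.init]

theorem causal_shift_injective {n : ℕ} (φ : Fin n → (Fin n → ℝ) → ℝ)
    (hc : ∀ i z z', (∀ s < i, z s = z' s) → φ i z = φ i z') :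
    Function.Injective (fun (z : Fin n → ℝ) i => φ i z + z i) := by
  intro z z' hz
  ext i
  induction i using WellFoundedLT.induction with
  | ind i ih =>
    have := congrFun hz i
    simp only [hc i z z' ih] at this
    linarith

/-- The logarithm of the likelihood ratio of `N(φ, 1)` to `N(0, v)` at the output `φ + z`. -/
def logRatio (v : ℝ) (φ z : ℝ) : ℝ :=
  1 / 2 * Real.log v - z ^ 2 / 2 + (φ + z) ^ 2 / (2 * v)

theorem gaussianPDF_mul_exp_neg_logRatio (v : NNReal) (hv : v ≠ 0) (φ z : ℝ) :
    gaussianPDF 0 1 z * ENNReal.ofReal (Real.exp (-logRatio v φ z)) =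
      gaussianPDF 0 v (φ + z) := by
  have hv' : (0 : ℝ) < v := by positivity
  rw [gaussianPDF, gaussianPDF, ← ENNReal.ofReal_mul (gaussianPDFReal_nonneg _ _ _)]
  congr 1
  simp only [gaussianPDFReal, logRatio]
  have h1 : Real.exp (-(1 / 2 * Real.log v)) = (√(v : ℝ))⁻¹ := by
    rw [Real.exp_neg, mul_comm, ← div_eq_mul_one_div, ← Real.log_sqrt hv'.le, Real.exp_log]
    exact Real.sqrt_pos.2 hv'
  rw [show -(1 / 2 * Real.log v - z ^ 2 / 2 + (φ + z) ^ 2 / (2 * v)) =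
    -(1 / 2 * Real.log v) + (z ^ 2 / 2 + -((φ + z) ^ 2 / (2 * v))) by ring, Real.exp_add, h1]
  simp only [NNReal.coe_one, mul_one, sub_zero]
  calc _ = (√(2 * Real.pi))⁻¹ * (√(v:ℝ))⁻¹ * (Real.exp (-z ^ 2 / 2) *
        Real.exp (z ^ 2 / 2 + -((φ + z) ^ 2 / (2 * v)))) := by ring
    _ = _ := by
      rw [← Real.exp_add, Real.sqrt_mul (by positivity : 0 ≤ 2 * Real.pi), mul_inv]
      congr 2
      ring

theorem pi_gaussianReal_eq_withDensity (n : ℕ) (v : NNReal) (hv : v ≠ 0) :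
    (Measure.pi fun _ : Fin n => gaussianReal 0 v) =
      (volume : Measure (Fin n → ℝ)).withDensity fun x => ∏ i, gaussianPDF 0 v (x i) := by
  have : SigmaFinite (gaussianReal 0 v) := inferInstance
  rw [gaussianReal_of_var_ne_zero 0 hv] at this ⊢
  exact pi_withDensity (fun _ => volume) (fun _ => gaussianPDF 0 v)
    fun _ => measurable_gaussianPDF 0 v

/-- Under the Gaussian reference output law, the set of outputs that `B` produces has the measure
obtained by weighting `B` with the likelihood ratio. -/
theorem setLIntegral_exp_neg_logRatio {n : ℕ} (v : NNReal) (hv : v ≠ 0)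
    (φ : Fin n → (Fin n → ℝ) → ℝ) (hφ : ∀ i, Measurable (φ i))
    (hc : ∀ i z z', (∀ s < i, z s = z' s) → φ i z = φ i z')
    (B : Set (Fin n → ℝ)) (hB : MeasurableSet B) :
    ∫⁻ z in B, ENNReal.ofReal (Real.exp (-∑ i, logRatio v (φ i z) (z i)))
        ∂(Measure.pi fun _ : Fin n => gaussianReal 0 1) =
      (Measure.pi fun _ : Fin n => gaussianReal 0 v) ((fun z i => φ i z + z i) '' B) := by
  have hT := measurePreserving_causal_shift φ hφ hc
  have hE := hT.measurable.measurableEmbedding (causal_shift_injective φ hc)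
  have hd : ∀ w : NNReal, Measurable fun x : Fin n → ℝ => ∏ i, gaussianPDF 0 w (x i) := fun w =>
    Finset.measurable_prod _ fun i _ => (measurable_gaussianPDF 0 w).comp (measurable_pi_apply i)
  have hl : ∀ i, Measurable fun z : Fin n → ℝ => logRatio v (φ i z) (z i) := by
    intro i
    have := hφ i
    unfold logRatio
    fun_prop
  rw [pi_gaussianReal_eq_withDensity n v hv, pi_gaussianReal_eq_withDensity n 1 one_ne_zero,
    withDensity_apply _ (hE.measurableSet_image.2 hB),
    setLIntegral_withDensity_eq_setLIntegral_mul _ (hd 1) _ hB,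
    ← hT.setLIntegral_comp_emb hE]
  · refine setLIntegral_congr_fun hB fun z _ => ?_
    simp only [Pi.mul_apply]
    rw [← Finset.sum_neg_distrib, Real.exp_sum,
      ENNReal.ofReal_prod_of_nonneg fun _ _ => (Real.exp_pos _).le, ← Finset.prod_mul_distrib]
    exact Finset.prod_congr rfl fun i _ => gaussianPDF_mul_exp_neg_logRatio v hv _ _
  · exact ENNReal.measurable_ofReal.comp (Real.measurable_exp.comp
      (Finset.measurable_sum _ fun i _ => hl i).neg)

/-! ### Information density of a causal input -/

theorem lintegral_uniformOn_univ {W : Type*} [Fintype W] [MeasurableSpace W]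
    [MeasurableSingletonClass W] (f : W → ENNReal) :
    ∫⁻ w, f w ∂uniformOn (Set.univ : Set W) = (Fintype.card W : ENNReal)⁻¹ * ∑ w, f w := by
  simp [uniformOn, ProbabilityTheory.cond, lintegral_count, tsum_fintype]

/-- The channel input at time `i` depends only on the noise before time `i`. -/
def Causal {W U : Type*} {n : ℕ} (φ : Fin n → W × U × (Fin n → ℝ) → ℝ) : Prop :=
  ∀ i w u z z', (∀ s < i, z s = z' s) → φ i (w, u, z) = φ i (w, u, z')

/-- The information density for the reference output law `N(0, v)`. -/
def infoDensity {W U : Type*} {n : ℕ} (v : ℝ) (φ : Fin n → W × U × (Fin n → ℝ) → ℝ)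
    (ω : W × U × (Fin n → ℝ)) : ℝ :=
  ∑ i, logRatio v (φ i ω) (ω.2.2 i)

theorem measurable_infoDensity {W U : Type*} [MeasurableSpace W] [MeasurableSpace U] {n : ℕ}
    {φ : Fin n → W × U × (Fin n → ℝ) → ℝ} (v : ℝ) (hφ : ∀ i, Measurable (φ i)) :
    Measurable (infoDensity v φ) := by
  refine Finset.measurable_sum _ fun i _ => ?_
  have := hφ i
  unfold logRatio
  fun_prop

/-- Messages uniform on `W`, side information with law `ν`, and independent standard Gaussian
noise. -/
def triple (W : Type*) [MeasurableSpace W] {U : Type*} [MeasurableSpace U] (ν : Measure U) (n : ℕ) :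
    Measure (W × U × (Fin n → ℝ)) :=
  (uniformOn (Set.univ : Set W)).prod (ν.prod (Measure.pi fun _ : Fin n => gaussianReal 0 1))

section Noise

variable {W U : Type*} [Fintype W] [MeasurableSpace W] [MeasurableSpace U]
  (ν : Measure U) [IsProbabilityMeasure ν] {n : ℕ} {φ : Fin n → W × U × (Fin n → ℝ) → ℝ}

/-- A causal input is uncorrelated with the current noise. -/
theorem integral_causal_mul_noise (hc : Causal φ) (i : Fin n) :
    ∫ ω, φ i ω * ω.2.2 i ∂triple W ν n = 0 := by
  -- Flipping the sign of the noise at time `i` preserves the law and leaves `φ i` unchanged, so the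
  -- integral equals its own negative.
  let e : Fin n → ℝ ≃ᵐ ℝ := fun j => if j = i then MeasurableEquiv.neg ℝ else MeasurableEquiv.refl ℝ
  have he : ∀ j, MeasurePreserving (e j) (gaussianReal 0 1) (gaussianReal 0 1) := by
    intro j
    by_cases h : j = i
    · simp only [e, h, if_true]
      refine ⟨measurable_neg, ?_⟩
      simpa using gaussianReal_map_neg (μ := 0) (v := 1)
    · simp only [e, h, if_false]
      exact MeasurePreserving.id _
  let E : (W × U × (Fin n → ℝ)) ≃ᵐ (W × U × (Fin n → ℝ)) :=
    (MeasurableEquiv.refl W).prodCongr ((MeasurableEquiv.refl U).prodCongr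
      (MeasurableEquiv.piCongrRight e))
  have hE : MeasurePreserving E (triple W ν n) (triple W ν n) :=
    (MeasurePreserving.id _).prod ((MeasurePreserving.id _).prod
      (measurePreserving_pi _ _ he))
  have h := hE.integral_comp' (fun ω => φ i ω * ω.2.2 i)
  have h2 : ∀ ω, φ i (E ω) * (E ω).2.2 i = -(φ i ω * ω.2.2 i) := by
    rintro ⟨w, u, z⟩
    have h3 : (E (w, u, z)).2.2 i = - z i := by
      simp [E, e, MeasurableEquiv.prodCongr, MeasurableEquiv.piCongrRight]
    have h4 : φ i (E (w, u, z)) = φ i (w, u, z) := by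
      refine hc i w u _ _ fun s hs => ?_
      simp [e, MeasurableEquiv.piCongrRight, hs.ne]
    rw [h3, h4]
    ring
  simp_rw [h2] at h
  rw [integral_neg] at h
  linarith

variable [Nonempty W]

instance : IsProbabilityMeasure (triple W ν n) := by
  unfold triple; infer_instance

theorem measurePreserving_noise : MeasurePreserving (fun ω : W × U × (Fin n → ℝ) => ω.2.2)
    (triple W ν n) (Measure.pi fun _ : Fin n => gaussianReal 0 1) :=
  measurePreserving_snd.comp measurePreserving_snd

theorem measurePreserving_noise_apply (i : Fin n) :
    MeasurePreserving (fun ω : W × U × (Fin n → ℝ) => ω.2.2 i) (triple W ν n) (gaussianReal 0 1) :=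
  (measurePreserving_eval (fun _ : Fin n => gaussianReal 0 1) i).comp (measurePreserving_noise ν)

theorem memLp_noise (i : Fin n) :
    MemLp (fun ω : W × U × (Fin n → ℝ) => ω.2.2 i) 2 (triple W ν n) :=
  (memLp_id_gaussianReal (μ := 0) (v := 1) 2).comp_measurePreserving
    (measurePreserving_noise_apply ν i)

theorem integral_noise_sq (i : Fin n) : ∫ ω, ω.2.2 i ^ 2 ∂triple W ν n = 1 := by
  have h := measurePreserving_noise_apply (W := W) ν i
  have h2 : ∫ x, x ^ 2 ∂gaussianReal 0 1 = 1 := by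
    have := variance_fun_id_gaussianReal (μ := 0) (v := 1)
    rw [variance_eq_integral aemeasurable_id'] at this
    simpa using this
  rw [← h2, ← h.map_eq, integral_map h.measurable.aemeasurable (by fun_prop)]

theorem integrable_logRatio (v : ℝ) (hL : ∀ i, MemLp (φ i) 2 (triple W ν n)) (i : Fin n) :
    Integrable (fun ω => logRatio v (φ i ω) (ω.2.2 i)) (triple W ν n) := by
  unfold logRatio
  exact ((integrable_const _).sub ((memLp_noise ν i).integrable_sq.div_const _)).add
    (((hL i).add (memLp_noise ν i)).integrable_sq.div_const _)

/-- The cross term of input and noise has mean zero, so the output has second moment `E φ² + 1`. The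
reference variance `1 + Q` is chosen so that, under the power constraint, the two quadratic terms of
`logRatio` add up to at most zero. -/
theorem integral_infoDensity_le (Q : ℝ) (hQ : 0 ≤ Q) (hc : Causal φ)
    (hL : ∀ i, MemLp (φ i) 2 (triple W ν n))
    (hP : ∑ i, ∫ ω, φ i ω ^ 2 ∂triple W ν n ≤ n * Q) :
    ∫ ω, infoDensity (1 + Q) φ ω ∂triple W ν n ≤ n * (1 / 2 * Real.log (1 + Q)) := by
  have h1 : ∀ i, ∫ ω, logRatio (1 + Q) (φ i ω) (ω.2.2 i) ∂triple W ν n =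
      1 / 2 * Real.log (1 + Q) - 1 / 2 + (∫ ω, φ i ω ^ 2 ∂triple W ν n + 1) / (2 * (1 + Q)) := by
    intro i
    have hz := memLp_noise (W := W) ν i
    have hφz : Integrable (fun ω => φ i ω * ω.2.2 i) (triple W ν n) := (hL i).integrable_mul hz
    have hsq : ∫ ω, (φ i ω + ω.2.2 i) ^ 2 ∂triple W ν n = ∫ ω, φ i ω ^ 2 ∂triple W ν n + 1 := by
      have : ∀ ω : W × U × (Fin n → ℝ), (φ i ω + ω.2.2 i) ^ 2 =
          φ i ω ^ 2 + 2 * (φ i ω * ω.2.2 i) + ω.2.2 i ^ 2 := fun ω => by ring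
      have hs : Integrable (fun ω => φ i ω ^ 2 + 2 * (φ i ω * ω.2.2 i)) (triple W ν n) :=
        (hL i).integrable_sq.add (hφz.const_mul 2)
      simp_rw [this]
      rw [integral_add hs hz.integrable_sq,
        integral_add (hL i).integrable_sq (hφz.const_mul 2), integral_const_mul,
        integral_causal_mul_noise ν hc, integral_noise_sq]
      ring
    have ha : Integrable (fun ω : W × U × (Fin n → ℝ) =>
        1 / 2 * Real.log (1 + Q) - ω.2.2 i ^ 2 / 2) (triple W ν n) :=
      (integrable_const _).sub (hz.integrable_sq.div_const _)
    have hb : Integrable (fun ω => (φ i ω + ω.2.2 i) ^ 2 / (2 * (1 + Q))) (triple W ν n) :=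
      ((hL i).add hz).integrable_sq.div_const _
    unfold logRatio
    rw [integral_add ha hb, integral_sub (integrable_const _)
      (hz.integrable_sq.div_const _), integral_div, integral_div, integral_noise_sq, hsq]
    simp
  unfold infoDensity
  rw [integral_finsetSum _ fun i _ => integrable_logRatio ν _ hL i, Finset.sum_congr rfl fun i _ => h1 i,
    Finset.sum_add_distrib, ← Finset.sum_div, Finset.sum_add_distrib]
  simp only [Finset.sum_const, Finset.card_univ, Fintype.card_fin, nsmul_eq_mul]
  have : (∑ i, ∫ ω, φ i ω ^ 2 ∂triple W ν n + n * 1) / (2 * (1 + Q)) ≤ n / 2 := by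
    rw [div_le_iff₀ (by positivity)]
    linarith
  linarith

end Noise

/-! ### Converse for the scalar Gaussian channel with feedback -/

section Converse

variable {W S U : Type*} [Fintype W] [MeasurableSpace W] [MeasurableSingletonClass W]
  [Fintype S] [MeasurableSpace U] (ν : Measure U) [IsProbabilityMeasure ν] {n : ℕ}

theorem lintegral_triple (F : W × U × (Fin n → ℝ) → ENNReal) (hF : Measurable F) :
    ∫⁻ ω, F ω ∂triple W ν n = (Fintype.card W : ENNReal)⁻¹ *
      ∫⁻ u, ∑ w, ∫⁻ z, F (w, u, z) ∂(Measure.pi fun _ : Fin n => gaussianReal 0 1) ∂ν := by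
  rw [triple, lintegral_prod _ hF.aemeasurable, lintegral_uniformOn_univ, lintegral_finsetSum]
  · congr 1
    refine Finset.sum_congr rfl fun w _ => ?_
    exact lintegral_prod _ (hF.comp measurable_prodMk_left).aemeasurable
  · exact fun w _ => (hF.comp measurable_prodMk_left).lintegral_prod_right'

variable {φ : Fin n → W × U × (Fin n → ℝ) → ℝ}

theorem setLIntegral_exp_neg_infoDensity (v : NNReal) (hv : v ≠ 0) (hφ : ∀ i, Measurable (φ i))
    (hc : Causal φ) (B : Set (W × U × (Fin n → ℝ))) (hB : MeasurableSet B) :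
    ∫⁻ ω in B, ENNReal.ofReal (Real.exp (-infoDensity v φ ω)) ∂triple W ν n =
      (Fintype.card W : ENNReal)⁻¹ * ∫⁻ u, ∑ w, (Measure.pi fun _ : Fin n => gaussianReal 0 v)
        ((fun z i => φ i (w, u, z) + z i) '' {z | (w, u, z) ∈ B}) ∂ν := by
  rw [← lintegral_indicator hB, lintegral_triple]
  · congr 1
    refine lintegral_congr fun u => Finset.sum_congr rfl fun w _ => ?_
    have hm : Measurable fun z : Fin n → ℝ => (w, u, z) :=
      measurable_prodMk_left.comp measurable_prodMk_left
    have hBm : MeasurableSet {z | (w, u, z) ∈ B} := hm hB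
    rw [← setLIntegral_exp_neg_logRatio v hv (fun i z => φ i (w, u, z))
      (fun i => (hφ i).comp hm) (fun i => hc i w u) _ hBm, ← lintegral_indicator hBm]
    rfl
  · exact (ENNReal.measurable_ofReal.comp (Real.measurable_exp.comp
      (measurable_infoDensity v hφ).neg)).indicator hB

/-- If the outputs and the side information of `B` determine the message, then `B` has small
weight under the reference output law. -/
theorem setLIntegral_exp_neg_infoDensity_le (side : W → S) (v : NNReal) (hv : v ≠ 0)
    (hφ : ∀ i, Measurable (φ i))
    (hc : Causal φ) (B : Set (W × U × (Fin n → ℝ))) (hB : MeasurableSet B)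
    (hdec : ∀ w w' u z z', (w, u, z) ∈ B → (w', u, z') ∈ B →
      (∀ i, φ i (w, u, z) + z i = φ i (w', u, z') + z' i) → side w = side w' → w = w') :
    ∫⁻ ω in B, ENNReal.ofReal (Real.exp (-infoDensity v φ ω)) ∂triple W ν n ≤
      (Fintype.card W : ENNReal)⁻¹ * Fintype.card S := by
  classical
  rw [setLIntegral_exp_neg_infoDensity ν v hv hφ hc B hB]
  gcongr
  calc _ ≤ ∫⁻ u, (Fintype.card S : ENNReal) ∂ν := ?_
    _ = _ := by simp
  refine lintegral_mono fun u => ?_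
  dsimp only
  -- Messages are grouped by side information. Within a group, decodability makes the output sets
  -- disjoint, so their reference probabilities add up to at most `1`.
  rw [← Finset.sum_fiberwise Finset.univ side]
  calc _ ≤ ∑ s : S, (1 : ENNReal) := Finset.sum_le_sum fun s _ => ?_
    _ = _ := by simp
  rw [← measure_biUnion_finset]
  · exact prob_le_one
  · intro w hw w' hw' hne
    refine Set.disjoint_left.2 ?_
    rintro _ ⟨z, hz, rfl⟩ ⟨z', hz', h⟩
    simp only [Finset.coe_filter, Finset.mem_univ, true_and, Set.mem_ofPred_eq] at hw hw'
    exact hne (hdec w w' u z z' hz hz' (fun i => (congrFun h i).symm) (hw.trans hw'.symm))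
  · intro w _
    have hm : Measurable fun z : Fin n → ℝ => (w, u, z) :=
      measurable_prodMk_left.comp measurable_prodMk_left
    have hT := measurePreserving_causal_shift (fun i z => φ i (w, u, z))
      (fun i => (hφ i).comp hm) (fun i => hc i w u)
    exact (hT.measurable.measurableEmbedding (causal_shift_injective _ fun i =>
      hc i w u)).measurableSet_image.2 (hm hB)

variable [Nonempty W]

theorem setLIntegral_exp_neg_infoDensity_le_one (v : NNReal) (hv : v ≠ 0)
    (hφ : ∀ i, Measurable (φ i))
    (hc : Causal φ) (B : Set (W × U × (Fin n → ℝ))) (hB : MeasurableSet B) :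
    ∫⁻ ω in B, ENNReal.ofReal (Real.exp (-infoDensity v φ ω)) ∂triple W ν n ≤ 1 := by
  rw [setLIntegral_exp_neg_infoDensity ν v hv hφ hc B hB]
  calc _ ≤ (Fintype.card W : ENNReal)⁻¹ * ∫⁻ u, ∑ w : W, 1 ∂ν := by
        gcongr
        exact prob_le_one
    _ = 1 := by
        simp [ENNReal.inv_mul_cancel]

/-- The converse for the Gaussian channel with feedback: a Fano-type bound on the probability of an
event `A` on which the outputs and the side information determine the message. -/
theorem measureReal_mul_log_le (side : W → S) [Nonempty S] (Q : ℝ) (hQ : 0 ≤ Q)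
    (hφ : ∀ i, Measurable (φ i)) (hc : Causal φ)
    (hL : ∀ i, MemLp (φ i) 2 (triple W ν n))
    (hP : ∑ i, ∫ ω, φ i ω ^ 2 ∂triple W ν n ≤ n * Q)
    (A : Set (W × U × (Fin n → ℝ))) (hA : MeasurableSet A)
    (hdec : ∀ w w' u z z', (w, u, z) ∈ A → (w', u, z') ∈ A →
      (∀ i, φ i (w, u, z) + z i = φ i (w', u, z') + z' i) → side w = side w' → w = w') :
    (triple W ν n).real A * Real.log (Fintype.card W / Fintype.card S) ≤
      n * (1 / 2 * Real.log (1 + Q)) + Real.log 2 := by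
  let v : NNReal := ⟨1 + Q, by positivity⟩
  have hv : v ≠ 0 := by
    have : (0 : ℝ) < 1 + Q := by positivity
    exact fun h => this.ne' (congrArg NNReal.toReal h)
  set K : ℝ := Fintype.card W / Fintype.card S with hK
  have hK0 : 0 < K := by positivity
  set Λ := infoDensity (1 + Q) φ with hΛ
  have hΛm : Measurable Λ := measurable_infoDensity _ hφ
  have hΛi : Integrable Λ (triple W ν n) :=
    integrable_finsetSum _ fun i _ => integrable_logRatio ν _ hL i
  have hem : Measurable fun ω => Real.exp (-Λ ω) := Real.measurable_exp.comp hΛm.neg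
  have hB : ∀ B, MeasurableSet B → ∫⁻ ω in B, ENNReal.ofReal (Real.exp (-Λ ω)) ∂triple W ν n ≤ 1 :=
    fun B hB => setLIntegral_exp_neg_infoDensity_le_one ν v hv hφ hc B hB
  have hAK := setLIntegral_exp_neg_infoDensity_le ν side v hv hφ hc A hA hdec
  have hei : Integrable (fun ω => Real.exp (-Λ ω)) (triple W ν n) := by
    refine ⟨hem.aestronglyMeasurable, ?_⟩
    rw [hasFiniteIntegral_iff_ofReal (Eventually.of_forall fun _ => (Real.exp_pos _).le)]
    have := hB Set.univ MeasurableSet.univ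
    rw [Measure.restrict_univ] at this
    exact this.trans_lt ENNReal.one_lt_top
  have hreal : ∀ B, ∫ ω in B, Real.exp (-Λ ω) ∂triple W ν n =
      (∫⁻ ω in B, ENNReal.ofReal (Real.exp (-Λ ω)) ∂triple W ν n).toReal := fun B =>
    integral_eq_lintegral_of_nonneg_ae (Eventually.of_forall fun _ => (Real.exp_pos _).le)
      hem.aestronglyMeasurable
  have h1 : ∫ ω in Aᶜ, Real.exp (-Λ ω) ∂triple W ν n ≤ 1 := by
    rw [hreal]
    exact ENNReal.toReal_le_of_le_ofReal zero_le_one (by simpa using hB Aᶜ hA.compl)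
  have h2 : ∫ ω in A, Real.exp (-Λ ω) ∂triple W ν n ≤ K⁻¹ := by
    rw [hreal]
    refine ENNReal.toReal_le_of_le_ofReal (by positivity) (hAK.trans_eq ?_)
    rw [hK, inv_div, div_eq_inv_mul, ENNReal.ofReal_mul (by positivity),
      ENNReal.ofReal_inv_of_pos (by positivity), ENNReal.ofReal_natCast, ENNReal.ofReal_natCast]
  -- This is `x + 1 ≤ exp x`, used here for `A` and below without `log K` for its complement. The
  -- shift by `log 2` makes each exponential integral contribute at most `1 / 2`, which together
  -- cancel the `-1`.
  have hpt1 : ∀ ω, Real.log K - Real.log 2 - Λ ω ≤ K / 2 * Real.exp (-Λ ω) - 1 := by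
    intro ω
    have := Real.add_one_le_exp (Real.log K - Real.log 2 - Λ ω)
    rw [sub_eq_add_neg _ (Λ ω), Real.exp_add, Real.exp_sub, Real.exp_log hK0,
      Real.exp_log two_pos] at this
    linarith
  have hpt2 : ∀ ω, - Real.log 2 - Λ ω ≤ 1 / 2 * Real.exp (-Λ ω) - 1 := by
    intro ω
    have := Real.add_one_le_exp (- Real.log 2 - Λ ω)
    rw [sub_eq_add_neg _ (Λ ω), Real.exp_add, Real.exp_neg, Real.exp_log two_pos] at this
    linarith
  have i1 := setIntegral_mono (s := A) (((integrable_const (Real.log K - Real.log 2)).sub hΛi).integrableOn)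
    (((hei.const_mul (K / 2)).sub (integrable_const 1)).integrableOn) hpt1
  have i2 := setIntegral_mono (s := Aᶜ) (((integrable_const (- Real.log 2)).sub hΛi).integrableOn)
    (((hei.const_mul (1 / 2)).sub (integrable_const 1)).integrableOn) hpt2
  have hsplit := integral_add_compl hA hΛi
  have hprob : (triple W ν n).real Aᶜ = 1 - (triple W ν n).real A := probReal_compl_eq_one_sub hA
  simp only [Pi.sub_apply] at i1 i2
  rw [integral_sub (integrable_const _).integrableOn hΛi.integrableOn,
    integral_sub (hei.const_mul _).integrableOn (integrable_const _).integrableOn,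
    integral_const_mul, setIntegral_const, setIntegral_const] at i1 i2
  simp only [smul_eq_mul] at i1 i2
  rw [hprob] at i2
  have hle := integral_infoDensity_le ν Q hQ hc hL hP
  have h3 : K / 2 * ∫ ω in A, Real.exp (-Λ ω) ∂triple W ν n ≤ 1 / 2 := by
    calc _ ≤ K / 2 * K⁻¹ := by gcongr
      _ = 1 / 2 := by field_simp
  change ∫ ω, Λ ω ∂triple W ν n ≤ _ at hle
  linarith

end Converse

/-! ### Splitting the noise along a unit direction -/

section Noise

variable {ι : Type*} [Fintype ι]

/-- Replaces the component of `x` in the direction of the unit vector `e` by `t`. -/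
def replaceComponent (e x : ι → ℝ) (t : ℝ) : ι → ℝ := fun v => x v + e v * (t - ∑ w, e w * x w)

theorem measurable_replaceComponent (e : ι → ℝ) :
    Measurable fun p : (ι → ℝ) × ℝ => replaceComponent e p.1 p.2 := by
  unfold replaceComponent
  fun_prop

theorem sum_mul_replaceComponent (e x : ι → ℝ) (t : ℝ) (he : ∑ v, e v ^ 2 = 1) :
    ∑ v, e v * replaceComponent e x t v = t := by
  have : ∀ v, e v * replaceComponent e x t v =
      e v * x v + e v ^ 2 * (t - ∑ w, e w * x w) := fun v => by
    unfold replaceComponent; ring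
  simp_rw [this]
  rw [Finset.sum_add_distrib, ← Finset.sum_mul, he]
  ring

/-- The component of a standard Gaussian vector along `e` is standard and independent of the
orthogonal part, so a fresh copy may replace it. The check is by characteristic functions: with `c =
⟨t, e⟩`, the exponents `|t - c e|²` and `c²` add up to `|t|²`. -/
theorem measurePreserving_replaceComponent (e : ι → ℝ) (he : ∑ v, e v ^ 2 = 1) :
    MeasurePreserving (fun p : (ι → ℝ) × ℝ => replaceComponent e p.1 p.2)
      ((Measure.pi fun _ => gaussianReal 0 1).prod (gaussianReal 0 1))
      (Measure.pi fun _ => gaussianReal 0 1) := by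
  refine ⟨measurable_replaceComponent e, ?_⟩
  set μ := (Measure.pi fun _ : ι => gaussianReal 0 1)
  have hm : Measurable (WithLp.toLp 2 : (ι → ℝ) → EuclideanSpace ℝ ι) :=
    (MeasurableEquiv.toLp 2 (ι → ℝ)).measurable
  refine (MeasurableEquiv.toLp 2 (ι → ℝ)).map_measurableEquiv_injective ?_
  change Measure.map (WithLp.toLp 2) _ = Measure.map (WithLp.toLp 2) _
  refine Measure.ext_of_charFun (E := EuclideanSpace ℝ ι) ?_
  ext t
  rw [charFun_pi, Measure.map_map hm (measurable_replaceComponent e), charFun_apply,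
    integral_map (hm.comp (measurable_replaceComponent e)).aemeasurable
      (by fun_prop)]
  set c := ∑ v, t v * e v
  have key : ∀ p : (ι → ℝ) × ℝ, Complex.exp (inner ℝ
      ((WithLp.toLp 2 ∘ fun p : (ι → ℝ) × ℝ => replaceComponent e p.1 p.2) p) t * Complex.I) =
      (∏ v, Complex.exp ((t v - c * e v : ℝ) * (p.1 v) * Complex.I)) *
        Complex.exp (c * p.2 * Complex.I) := by
    rintro ⟨x, s⟩
    rw [← Complex.exp_sum, ← Complex.exp_add]
    congr 1
    rw [← Finset.sum_mul, ← add_mul]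
    congr 1
    norm_cast
    simp only [Function.comp, PiLp.inner_apply, replaceComponent, RCLike.inner_apply, conj_trivial]
    have h1 : ∀ v, t v * (x v + e v * (s - ∑ w, e w * x w)) =
      t v * x v + t v * e v * (s - ∑ w, e w * x w) := fun v => by ring
    simp_rw [h1]
    rw [Finset.sum_add_distrib, ← Finset.sum_mul]
    simp_rw [sub_mul, mul_assoc]
    rw [Finset.sum_sub_distrib, ← Finset.mul_sum]
    change _ + c * _ = _
    ring
  simp_rw [key]
  rw [integral_prod_mul (fun x : ι → ℝ => ∏ v, Complex.exp ((t v - c * e v : ℝ) * (x v) * Complex.I))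
    (fun s : ℝ => Complex.exp (c * s * Complex.I)),
    integral_fintype_prod_eq_prod (fun v (x : ℝ) => Complex.exp ((t v - c * e v : ℝ) * x * Complex.I))]
  have h2 : ∀ r : ℝ, ∫ x, Complex.exp (r * x * Complex.I) ∂gaussianReal 0 1 =
      Complex.exp (- (r ^ 2 / 2 : ℝ)) := by
    intro r
    rw [← charFun_apply_real, charFun_gaussianReal]
    congr 1
    push_cast
    simp
  simp_rw [h2]
  simp only [charFun_gaussianReal]
  rw [← Complex.exp_sum, ← Complex.exp_add, ← Complex.exp_sum]
  congr 1
  push_cast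
  simp only [mul_zero, zero_mul, zero_sub]
  norm_cast
  simp only [Finset.sum_neg_distrib, ← Finset.sum_div, one_mul]
  have h3 : ∑ v, (t v - c * e v) ^ 2 = ∑ v, t v ^ 2 - c ^ 2 := by
    have : ∀ v, (t v - c * e v) ^ 2 = t v ^ 2 - 2 * c * (t v * e v) + c ^ 2 * e v ^ 2 :=
      fun v => by ring
    simp_rw [this]
    rw [Finset.sum_add_distrib, Finset.sum_sub_distrib, ← Finset.mul_sum, ← Finset.mul_sum, he]
    change _ - 2 * c * c + _ = _
    ring
  push_cast at h3 ⊢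
  rw [← neg_add, ← add_div, show (∑ v, ((t v : ℂ) - c * e v) ^ 2) = ∑ v, (t v : ℂ) ^ 2 - c ^ 2 by
    exact_mod_cast congrArg Complex.ofReal h3]
  ring

/-- The direction `e` mixes nodes at each fixed time, whereas `Noise` is indexed by node first; this
transposes the two. Both measures agree on products of boxes, a generating π-system. -/
theorem measurePreserving_swap_pi {κ : Type*} [Fintype κ] (γ : Measure ℝ) [IsProbabilityMeasure γ] :
    MeasurePreserving (fun (x : κ → ι → ℝ) v i => x i v)
      (Measure.pi fun _ : κ => Measure.pi fun _ : ι => γ)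
      (Measure.pi fun _ : ι => Measure.pi fun _ : κ => γ) := by
  have hm : Measurable (fun (x : κ → ι → ℝ) v i => x i v) := by fun_prop
  refine ⟨hm, ((Measure.pi_eq_generateFrom (μ := fun _ : ι => Measure.pi fun _ : κ => γ)
    (C := fun _ => Set.univ.pi '' Set.univ.pi fun _ : κ => {s : Set ℝ | MeasurableSet s})
    (fun _ => generateFrom_pi) (fun _ => isPiSystem_pi) (fun _ => ?_) fun s hs => ?_)).symm⟩
  · exact ⟨fun _ => Set.univ, fun _ => ⟨fun _ => Set.univ, by simp, by simp⟩,
      fun _ => measure_lt_top _ _, Set.iUnion_const _⟩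
  · choose r hr hrs using hs
    have hr' : ∀ v i, MeasurableSet (r v i) := fun v i => hr v i trivial
    have hsm : ∀ v, MeasurableSet (s v) := fun v => hrs v ▸ MeasurableSet.univ_pi (hr' v)
    rw [Measure.map_apply hm (MeasurableSet.univ_pi hsm)]
    have : (fun (x : κ → ι → ℝ) v i => x i v) ⁻¹' Set.univ.pi s =
        Set.univ.pi fun i => Set.univ.pi fun v => r v i := by
      ext x
      simp only [← hrs, Set.mem_preimage, Set.mem_pi, Set.mem_univ, true_implies]
      exact forall_comm
    rw [this, Measure.pi_pi]
    simp_rw [Measure.pi_pi, ← hrs, Measure.pi_pi]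
    exact Finset.prod_comm

end Noise

/-- Builds the noise from independent noise `u` and noise `z`, where `z` becomes the component of
the noise in the direction of `e`. -/
def mixNoise {n : ℕ} (e : Node → ℝ) (p : (Fin n → Node → ℝ) × (Fin n → ℝ)) : Noise n :=
  fun v i => replaceComponent e (p.1 i) (p.2 i) v

theorem measurePreserving_mixNoise {n : ℕ} (e : Node → ℝ) (he : ∑ v, e v ^ 2 = 1) :
    MeasurePreserving (mixNoise (n := n) e)
      ((Measure.pi fun _ : Fin n => Measure.pi fun _ : Node => gaussianReal 0 1).prod
        (Measure.pi fun _ : Fin n => gaussianReal 0 1))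
      (Measure.pi fun _ : Node => Measure.pi fun _ : Fin n => gaussianReal 0 1) := by
  have h1 := measurePreserving_pi
    (fun _ : Fin n => (Measure.pi fun _ : Node => gaussianReal 0 1).prod (gaussianReal 0 1)) _
    fun _ => measurePreserving_replaceComponent e he
  exact ((measurePreserving_swap_pi (gaussianReal 0 1)).comp h1).comp
    (measurePreserving_arrowProdEquivProdArrow (Node → ℝ) ℝ (Fin n)
      (fun _ => Measure.pi fun _ : Node => gaussianReal 0 1) fun _ => gaussianReal 0 1).symm

/-! ### Causality and measurability of the channel signals -/

section Code

variable {M : Link → ℕ} {n : ℕ} (c : Code M n) (h : Fin 3 → ℝ)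

theorem Code.received_congr (m : Messages M) (z z' : Noise n) (i : Fin n)
    (hz : ∀ s ≤ i, ∀ v, z v s = z' v s) (v : Node) :
    c.received h m z i v = c.received h m z' i v := by
  induction i using WellFoundedLT.induction generalizing v with
  | ind i ih =>
    have ih' : ∀ (s : Fin i) v, c.received h m z ⟨s, s.2.trans i.2⟩ v =
        c.received h m z' ⟨s, s.2.trans i.2⟩ v := fun s v =>
      ih ⟨s, s.2.trans i.2⟩ s.2 (fun t ht v => hz t (ht.trans s.2.le) v) v
    cases v with
    | none =>
      rw [Code.received, Code.received, hz i le_rfl]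
      simp only [ih']
    | some j =>
      rw [Code.received, Code.received, hz i le_rfl]
      simp only [ih']

theorem Code.userInput_congr (j : Fin 3) (m : Messages M) (z z' : Noise n) (i : Fin n)
    (hz : ∀ s < i, ∀ v, z v s = z' v s) :
    c.userInput h j i (m, z) = c.userInput h j i (m, z') := by
  simp only [Code.userInput]
  congr 1
  ext s
  exact c.received_congr h m z z' _ (fun t ht v => hz t (lt_of_le_of_lt ht s.2) v) _

theorem Code.relayInput_congr (m : Messages M) (z z' : Noise n) (i : Fin n)
    (hz : ∀ s < i, ∀ v, z v s = z' v s) :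
    c.relayInput h i (m, z) = c.relayInput h i (m, z') := by
  simp only [Code.relayInput]
  congr 1
  ext s
  exact c.received_congr h m z z' _ (fun t ht v => hz t (lt_of_le_of_lt ht s.2) v) _

theorem Code.measurable_received_right (m : Messages M) (i : Fin n) (v : Node) :
    Measurable fun z : Noise n => c.received h m z i v := by
  induction i using WellFoundedLT.induction generalizing v with
  | ind i ih =>
    have ih' : ∀ v, Measurable fun (z : Noise n) (s : Fin i) =>
        c.received h m z ⟨s, s.2.trans i.2⟩ v := fun v =>
      measurable_pi_lambda _ fun s => ih ⟨s, s.2.trans i.2⟩ s.2 v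
    have hz : ∀ v, Measurable fun z : Noise n => z v i := fun v =>
      (measurable_pi_apply i).comp (measurable_pi_apply v)
    cases v with
    | none =>
      rw [show (fun z : Noise n => c.received h m z i none) = _ from
        funext fun z => c.received_relay h (m, z) i]
      exact (Finset.measurable_sum _ fun j _ =>
        ((c.measurable_encode j i (own m j)).comp (ih' (some j))).const_mul (h j)).add (hz none)
    | some j =>
      rw [show (fun z : Noise n => c.received h m z i (some j)) = _ from
        funext fun z => c.received_user h (m, z) i j]
      exact (((c.measurable_relay i).comp (ih' none)).const_mul _).add (hz (some j))

theorem Code.measurable_received (i : Fin n) (v : Node) :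
    Measurable fun ω : Messages M × Noise n => c.received h ω.1 ω.2 i v :=
  measurable_from_prod_countable_right fun m => c.measurable_received_right h m i v

theorem Code.measurable_userInput (j : Fin 3) (i : Fin n) : Measurable (c.userInput h j i) :=
  measurable_from_prod_countable_right fun m => (c.measurable_encode j i (own m j)).comp
    (measurable_pi_lambda (fun z (s : Fin i) => c.received h m z ⟨s, s.2.trans i.2⟩ (some j))
      fun _ => c.measurable_received_right h m _ _)

theorem Code.measurable_relayInput (i : Fin n) : Measurable (c.relayInput h i) :=
  (c.measurable_relay i).comp (measurable_pi_lambda _ fun _ => c.measurable_received h _ _)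

/-- The event that user `j` decodes correctly. -/
def Code.correct (j : Fin 3) : Set (Messages M × Noise n) :=
  {ω | c.decode j (fun i => c.received h ω.1 ω.2 i (some j)) (own ω.1 j) = desired ω.1 j}

theorem Code.measurableSet_correct (j : Fin 3) : MeasurableSet (c.correct h j) := by
  have h1 : Measurable fun ω : Messages M × Noise n =>
      c.decode j (fun i => c.received h ω.1 ω.2 i (some j)) (own ω.1 j) :=
    measurable_from_prod_countable_right fun m => (c.measurable_decode j (own m j)).comp
      (measurable_pi_lambda (fun z i => c.received h m z i (some j)) fun _ => c.measurable_received_right h m _ _)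
  have h2 : Measurable fun ω : Messages M × Noise n => desired ω.1 j :=
    (measurable_of_countable fun m : Messages M => desired m j).comp measurable_fst
  exact measurableSet_eq_fun h1 h2

instance [∀ p, NeZero (M p)] : IsProbabilityMeasure (law M n) := by
  unfold law; infer_instance

theorem Code.one_sub_errorProb_le [∀ p, NeZero (M p)] (j l : Fin 3) :
    1 - c.errorProb h ≤ (law M n).real (c.correct h j ∩ c.correct h l) := by
  have h1 := probReal_compl_eq_one_sub (μ := law M n)
    ((c.measurableSet_correct h j).inter (c.measurableSet_correct h l))
  have h2 : (law M n).real (c.correct h j ∩ c.correct h l)ᶜ ≤ c.errorProb h := by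
    refine measureReal_mono ?_
    intro ω hω
    rw [Set.compl_inter] at hω
    rcases hω with hω | hω
    · exact ⟨j, hω⟩
    · exact ⟨l, hω⟩
  linarith

/-! ### The genie argument on the downlink and the uplink -/

/-- The messages intended for user `j`, and the one from the third user to user `l`. -/
def genieLinks (j l : Fin 3) : Finset Link :=
  Finset.univ.filter fun p => p.1.2 = j ∨ (p.1.2 = l ∧ p.1.1 ≠ j)

/-- The messages outside a set of links. -/
abbrev SideMessages (M : Link → ℕ) (T : Finset Link) : Type := (p : {p : Link // p ∉ T}) → Fin (M p)

/-- Restriction of the message vector to the links outside `T`. -/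
def sideMessages (T : Finset Link) (m : Messages M) : SideMessages M T := fun p => m p.1

/-- No link starting at `j` lies in `genieLinks j l`, so the side messages contain everything `j`
sends. -/
theorem own_eq_of_sideMessages_eq {j l : Fin 3} {m m' : Messages M}
    (hs : sideMessages (genieLinks j l) m = sideMessages (genieLinks j l) m') :
    own m j = own m' j := by
  ext p : 1
  refine congrFun hs ⟨p.1, ?_⟩
  have h1 := p.1.2
  have h2 := p.2
  simp only [genieLinks, Finset.mem_filter, Finset.mem_univ, true_and]
  rintro (h | h)
  · exact h1 (h2.trans h.symm)
  · exact h.2 h2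

/-- From the outputs of the users `j` and `l` and the side messages, correct decoders recover all
the messages. -/
theorem Code.eq_of_correct {j l : Fin 3} {m m' : Messages M} {z z' : Noise n}
    (hm : (m, z) ∈ c.correct h j ∩ c.correct h l) (hm' : (m', z') ∈ c.correct h j ∩ c.correct h l)
    (hj : ∀ i, c.received h m z i (some j) = c.received h m' z' i (some j))
    (hl : ∀ i, c.received h m z i (some l) = c.received h m' z' i (some l))
    (hs : sideMessages (genieLinks j l) m = sideMessages (genieLinks j l) m') : m = m' := by
  have hside : ∀ p, p ∉ genieLinks j l → m p = m' p := fun p hp => congrFun hs ⟨p, hp⟩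
  have hd : desired m j = desired m' j := by
    rw [← show _ = desired m j from hm.1, ← show _ = desired m' j from hm'.1]
    simp only [hj, own_eq_of_sideMessages_eq hs]
  have hdj : ∀ p : Link, p.1.2 = j → m p = m' p := fun p hp => congrFun hd ⟨p, hp⟩
  -- Of the two messages of `l`, the one to `j` has just been decoded and the other is a side
  -- message.
  have hol : own m l = own m' l := by
    ext p : 1
    by_cases hp : p.1 ∈ genieLinks j l
    · simp only [genieLinks, Finset.mem_filter, Finset.mem_univ, true_and] at hp
      rcases hp with hp | hp
      · exact hdj _ hp
      · exact absurd (p.2.trans hp.1.symm) p.1.2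
    · exact hside _ hp
  have hdl : desired m l = desired m' l := by
    rw [← show _ = desired m l from hm.2, ← show _ = desired m' l from hm'.2]
    simp only [hl, hol]
  ext p : 1
  by_cases hp : p ∈ genieLinks j l
  · simp only [genieLinks, Finset.mem_filter, Finset.mem_univ, true_and] at hp
    rcases hp with hp | hp
    · exact hdj _ hp
    · exact congrFun hdl ⟨p, hp.1⟩
  · exact hside _ hp

theorem card_messages_div (T : Finset Link) [∀ p, NeZero (M p)] :
    (Fintype.card (Messages M) : ℝ) / Fintype.card (SideMessages M T) = ∏ p ∈ T, (M p : ℝ) := by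
  have h0 : ∀ p, (M p : ℝ) ≠ 0 := fun p => Nat.cast_ne_zero.2 (NeZero.ne _)
  rw [Fintype.card_pi, Fintype.card_pi]
  simp only [Fintype.card_fin, Nat.cast_prod]
  rw [div_eq_iff (Finset.prod_ne_zero_iff.2 fun p _ => h0 _),
    ← Finset.prod_mul_prod_compl T]
  congr 1
  exact Finset.prod_subtype _ (by simp) _

/-- The Fano-type bound for the channel: `x` is the signal received in the direction `e` of the
noise. -/
theorem measureReal_law_mul_log_le [∀ p, NeZero (M p)] (T : Finset Link) (e : Node → ℝ)
    (he : ∑ v, e v ^ 2 = 1)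
    (x : Fin n → Messages M × Noise n → ℝ) (hx : ∀ i, Measurable (x i))
    (hc : ∀ i m z z', (∀ s < i, ∀ v, z v s = z' v s) → x i (m, z) = x i (m, z'))
    (Q : ℝ) (hQ : 0 ≤ Q) (hL : ∀ i, MemLp (x i) 2 (law M n))
    (hP : ∑ i, ∫ ω, x i ω ^ 2 ∂law M n ≤ n * Q)
    (A : Set (Messages M × Noise n)) (hA : MeasurableSet A)
    (hdec : ∀ m m' z z', (m, z) ∈ A → (m', z') ∈ A →
      (∀ i, x i (m, z) + ∑ v, e v * z v i = x i (m', z') + ∑ v, e v * z' v i) →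
      (∀ v i, z v i - e v * ∑ w, e w * z w i = z' v i - e v * ∑ w, e w * z' w i) →
      sideMessages T m = sideMessages T m' → m = m') :
    (law M n).real A * ∑ p ∈ T, Real.log (M p) ≤ n * (1 / 2 * Real.log (1 + Q)) + Real.log 2 := by
  -- The auxiliary noise `u` with law `ν` is the genie's side information: it fixes the part of the
  -- noise orthogonal to `e`, and the fresh component along `e` is the noise of the scalar channel.
  let ν := Measure.pi fun _ : Fin n => Measure.pi fun _ : Node => gaussianReal 0 1
  let Ψ : Messages M × (Fin n → Node → ℝ) × (Fin n → ℝ) → Messages M × Noise n :=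
    Prod.map id (mixNoise e)
  have hΨ : MeasurePreserving Ψ (triple (Messages M) ν n) (law M n) :=
    (MeasurePreserving.id _).prod (measurePreserving_mixNoise e he)
  have hint : ∀ i, ∫ ω, x i (Ψ ω) ^ 2 ∂triple (Messages M) ν n = ∫ ω, x i ω ^ 2 ∂law M n := by
    intro i
    rw [← hΨ.map_eq, integral_map hΨ.measurable.aemeasurable
      ((hx i).pow_const 2).aestronglyMeasurable]
  have hcomp : ∀ u ζ i, ∑ v, e v * mixNoise (n := n) e (u, ζ) v i = ζ i := fun u ζ i =>
    sum_mul_replaceComponent e (u i) (ζ i) he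
  have key := measureReal_mul_log_le ν (φ := fun i ω => x i (Ψ ω)) (sideMessages T) Q hQ
    (fun i => (hx i).comp hΨ.measurable)
    (fun i m u ζ ζ' hζ => hc i m _ _ fun s hs v => by simp only [mixNoise, hζ s hs])
    (fun i => (hL i).comp_measurePreserving hΨ)
    (by simpa only [hint] using hP) (Ψ ⁻¹' A) (hΨ.measurable hA) (by
      intro m m' u ζ ζ' hm hm' hy hs
      refine hdec m m' _ _ hm hm' (fun i => ?_) (fun v i => ?_) hs
      · rw [hcomp, hcomp]
        exact hy i
      · rw [hcomp, hcomp]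
        simp only [mixNoise, replaceComponent]
        ring)
  rw [measureReal_def, hΨ.measure_preimage hA.nullMeasurableSet, card_messages_div,
    Real.log_prod fun p _ => Nat.cast_ne_zero.2 (NeZero.ne _)] at key
  exact key

theorem Code.downlink_bound [∀ p, NeZero (M p)] (P : ℝ) (hP0 : 0 ≤ P)
    (hP : c.PowerConstraint h P) (j l : Fin 3)
    (hjl : j ≠ l) : (1 - c.errorProb h) * ∑ p ∈ genieLinks j l, Real.log (M p) ≤
      n * (1 / 2 * Real.log (1 + (h j ^ 2 + h l ^ 2) * P)) + Real.log 2 := by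
  -- Maximal-ratio combining: along the unit vector `(a, b)` the two outputs form a scalar channel
  -- of gain `s`, and orthogonally to it they carry only noise. If both gains vanish, any unit
  -- vector serves with `s = 0`.
  obtain ⟨s, a, b, hab, hj, hl⟩ : ∃ s a b : ℝ, a ^ 2 + b ^ 2 = 1 ∧ h j = s * a ∧ h l = s * b := by
    by_cases h0 : h j ^ 2 + h l ^ 2 = 0
    · refine ⟨0, 1, 0, by norm_num, ?_, ?_⟩ <;> nlinarith [sq_nonneg (h j), sq_nonneg (h l)]
    · have hpos : 0 < h j ^ 2 + h l ^ 2 := lt_of_le_of_ne (by positivity) (Ne.symm h0)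
      have hs := Real.sqrt_pos.2 hpos
      refine ⟨√(h j ^ 2 + h l ^ 2), h j / √(h j ^ 2 + h l ^ 2), h l / √(h j ^ 2 + h l ^ 2), ?_,
        by field_simp, by field_simp⟩
      rw [div_pow, div_pow, Real.sq_sqrt hpos.le]
      field_simp
  have hs2 : h j ^ 2 + h l ^ 2 = s ^ 2 := by rw [hj, hl]; linear_combination s ^ 2 * hab
  let e : Node → ℝ := fun v => if v = some j then a else if v = some l then b else 0
  have hej : e (some j) = a := by simp [e]
  have hel : e (some l) = b := by simp [e, hjl.symm]
  have he : ∑ v, e v ^ 2 = 1 := by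
    rw [Finset.sum_eq_add (some j) (some l) (by simpa using hjl), hej, hel, hab]
    · rintro v - ⟨h1, h2⟩
      simp [e, h1, h2]
    · simp
    · simp
  have hlog : 0 ≤ ∑ p ∈ genieLinks j l, Real.log (M p) := Finset.sum_nonneg fun p _ =>
    Real.log_natCast_nonneg _
  refine (mul_le_mul_of_nonneg_right (c.one_sub_errorProb_le h j l) hlog).trans ?_
  refine measureReal_law_mul_log_le _ e he (fun i ω => s * c.relayInput h i ω)
    (fun i => (c.measurable_relayInput h i).const_mul s)
    (fun i m z z' hz => by simp only [c.relayInput_congr h m z z' i hz]) _ (by positivity)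
    (fun i => (hP.2.1 i).const_mul s) ?_ _
    ((c.measurableSet_correct h j).inter (c.measurableSet_correct h l)) ?_
  · simp_rw [mul_pow, integral_const_mul]
    rw [← Finset.mul_sum, hs2]
    have := mul_le_mul_of_nonneg_left hP.2.2 (sq_nonneg s)
    linarith
  · intro m m' z z' hm hm' hy hr hs
    have hrec : ∀ v i, h v = s * e (some v) →
        c.received h m z i (some v) = c.received h m' z' i (some v) := by
      intro v i hv
      rw [c.received_user h (m, z), c.received_user h (m', z'), hv]
      linear_combination e (some v) * hy i + hr (some v) i
    exact c.eq_of_correct h hm hm' (fun i => hrec j i (hej ▸ hj)) (fun i => hrec l i (hel ▸ hl)) hs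

theorem Code.uplink_bound [∀ p, NeZero (M p)] (P : ℝ) (hP0 : 0 ≤ P)
    (hP : c.PowerConstraint h P) (j k l : Fin 3) (hjk : j ≠ k)
    (hjl : j ≠ l) (hkl : k ≠ l) : (1 - c.errorProb h) * ∑ p ∈ genieLinks j l, Real.log (M p) ≤
      n * (1 / 2 * Real.log (1 + (|h k| + |h l|) ^ 2 * P)) + Real.log 2 := by
  have hsum : ∀ f : Fin 3 → ℝ, ∑ v, f v = f j + (f k + f l) := by
    intro f
    rw [← Finset.add_sum_erase _ _ (Finset.mem_univ j), Finset.sum_eq_add k l hkl]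
    · intro v hv h2
      rw [Finset.mem_erase] at hv
      omega
    · exact fun h' => absurd (by simp [hjk.symm]) h'
    · exact fun h' => absurd (by simp [hjl.symm]) h'
  -- Only the relay noise is the channel noise; the noises of all users become side information.
  let e : Node → ℝ := fun v => if v = none then 1 else 0
  have hez : ∀ (z : Noise n) i, ∑ v, e v * z v i = z none i := fun z i => by simp [e]
  have he : ∑ v, e v ^ 2 = 1 := by simp [e]
  have hlog : 0 ≤ ∑ p ∈ genieLinks j l, Real.log (M p) := Finset.sum_nonneg fun p _ =>
    Real.log_natCast_nonneg _
  refine (mul_le_mul_of_nonneg_right (c.one_sub_errorProb_le h j l) hlog).trans ?_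
  have hLk := fun i => (hP.1 k).1 i
  have hLl := fun i => (hP.1 l).1 i
  refine measureReal_law_mul_log_le _ e he
    (fun i ω => h k * c.userInput h k i ω + h l * c.userInput h l i ω)
    (fun i => ((c.measurable_userInput h k i).const_mul _).add
      ((c.measurable_userInput h l i).const_mul _))
    (fun i m z z' hz => by simp only [c.userInput_congr h _ m z z' i hz]) _ (by positivity)
    (fun i => ((hLk i).const_mul _).add ((hLl i).const_mul _)) ?_ _
    ((c.measurableSet_correct h j).inter (c.measurableSet_correct h l)) ?_
  · have hpt : ∀ i, ∫ ω, (h k * c.userInput h k i ω + h l * c.userInput h l i ω) ^ 2 ∂law M n ≤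
        (|h k| + |h l|) * (|h k| * ∫ ω, c.userInput h k i ω ^ 2 ∂law M n +
          |h l| * ∫ ω, c.userInput h l i ω ^ 2 ∂law M n) := by
      intro i
      have i1 := (hLk i).integrable_sq.const_mul |h k|
      have i2 := (hLl i).integrable_sq.const_mul |h l|
      rw [← integral_const_mul, ← integral_const_mul, ← integral_add i1 i2, ← integral_const_mul]
      refine integral_mono (((hLk i).const_mul _).add ((hLl i).const_mul _)).integrable_sq
        ((i1.add i2).const_mul _) fun ω => ?_
      dsimp only
      set x := c.userInput h k i ω
      set y := c.userInput h l i ω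
      -- With feedback the two inputs may be correlated, so the cross term is bounded by the powers
      -- and the gain is `(|h k| + |h l|) ^ 2` instead of a sum of squares.
      have hxy : h k * h l * (x * y) * 2 ≤ |h k| * |h l| * (x ^ 2 + y ^ 2) := by
        calc h k * h l * (x * y) * 2 ≤ |h k * h l * (x * y) * 2| := le_abs_self _
          _ = |h k| * |h l| * (2 * |x| * |y|) := by
            rw [abs_mul, abs_mul, abs_mul, abs_mul, abs_two]; ring
          _ ≤ |h k| * |h l| * (x ^ 2 + y ^ 2) := by
            gcongr
            rw [← sq_abs x, ← sq_abs y]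
            exact two_mul_le_add_sq _ _
      have e1 := sq_abs (h k)
      have e2 := sq_abs (h l)
      calc (h k * x + h l * y) ^ 2 = h k ^ 2 * x ^ 2 + h l ^ 2 * y ^ 2 + h k * h l * (x * y) * 2 := by
            ring
        _ ≤ |h k| ^ 2 * x ^ 2 + |h l| ^ 2 * y ^ 2 + |h k| * |h l| * (x ^ 2 + y ^ 2) := by
            rw [e1, e2]; linarith
        _ = _ := by ring
    refine (Finset.sum_le_sum fun i _ => hpt i).trans ?_
    rw [← Finset.mul_sum, Finset.sum_add_distrib, ← Finset.mul_sum, ← Finset.mul_sum]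
    have b1 := (hP.1 k).2
    have b2 := (hP.1 l).2
    calc _ ≤ (|h k| + |h l|) * (|h k| * (n * P) + |h l| * (n * P)) := by gcongr
      _ = _ := by ring
  · intro m m' z z' hm hm' hy hr hs
    simp only [hez] at hy hr
    have hu : ∀ v i, z (some v) i = z' (some v) i := fun v i => by simpa [e] using hr (some v) i
    have hown := own_eq_of_sideMessages_eq hs
    -- Induction on time: equal past outputs and equal messages of `j` give equal inputs of `j`, so
    -- its contribution can be added back to the relay output. The relay input and the known user
    -- noises then fix the user outputs.
    have hrec : ∀ i v, c.received h m z i v = c.received h m' z' i v := by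
      intro i
      induction i using WellFoundedLT.induction with
      | ind i ih =>
        have ih' : ∀ (s : Fin i) v, c.received h m z ⟨s, s.2.trans i.2⟩ v =
            c.received h m' z' ⟨s, s.2.trans i.2⟩ v := fun s v => ih ⟨s, s.2.trans i.2⟩ s.2 v
        intro v
        cases v with
        | none =>
          have hj : c.userInput h j i (m, z) = c.userInput h j i (m', z') := by
            simp only [Code.userInput, ih', hown]
          rw [c.received_relay h (m, z), c.received_relay h (m', z'), hsum, hsum, hj]
          linear_combination hy i
        | some v =>
          rw [c.received_user h (m, z), c.received_user h (m', z')]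
          simp only [Code.relayInput, ih', hu]
    exact c.eq_of_correct h hm hm' (fun i => hrec i _) (fun i => hrec i _) hs

end Code

/-! ### From codes to rates: the bound on the sum-capacity -/

theorem neZero_messageCount {R : Rates} (hR : ∀ p, 0 ≤ R p) (n : ℕ) (p : Link) :
    NeZero (messageCount R n p) :=
  ⟨(Nat.floor_pos.2 (Real.one_le_rpow one_le_two (mul_nonneg n.cast_nonneg (hR p)))).ne'⟩

/-- Since `1 ≤ x`, rounding down loses at most a factor `2`, a constant that vanishes after division
by `n`. -/
theorem le_log_messageCount {R : Rates} (hR : ∀ p, 0 ≤ R p) (n : ℕ) (p : Link) :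
    n * R p * Real.log 2 - Real.log 2 ≤ Real.log (messageCount R n p) := by
  set x : ℝ := 2 ^ ((n : ℝ) * R p) with hx
  have h1 : 1 ≤ x := Real.one_le_rpow one_le_two (mul_nonneg n.cast_nonneg (hR p))
  have h2 : x / 2 ≤ (⌊x⌋₊ : ℝ) := by
    have h3 := Nat.lt_floor_add_one x
    have h4 : (1 : ℝ) ≤ (⌊x⌋₊ : ℝ) := by exact_mod_cast Nat.floor_pos.2 h1
    linarith
  have h5 := Real.log_le_log (by positivity) h2
  rw [Real.log_div (by positivity) two_ne_zero, hx, Real.log_rpow two_pos] at h5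
  exact h5

/-- Rates that satisfy a Fano-type bound with vanishing error satisfy the capacity bound. -/
theorem sum_rates_le_cap {R : Rates} (hR : ∀ p, 0 ≤ R p) (T : Finset Link) (Q : ℝ) (ε : ℕ → ℝ)
    (hε : Tendsto ε atTop (𝓝 0))
    (hF : ∀ n : ℕ, (1 - ε n) * ∑ p ∈ T, Real.log (messageCount R n p) ≤
      n * (1 / 2 * Real.log (1 + Q)) + Real.log 2) :
    ∑ p ∈ T, R p ≤ cap Q := by
  have hl2 : 0 < Real.log 2 := Real.log_pos one_lt_two
  set r := ∑ p ∈ T, R p with hr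
  have hlow : ∀ n : ℕ, n * r * Real.log 2 - T.card * Real.log 2 ≤
      ∑ p ∈ T, Real.log (messageCount R n p) := by
    intro n
    have := Finset.sum_le_sum fun p (_ : p ∈ T) => le_log_messageCount hR n p
    rw [Finset.sum_sub_distrib, ← Finset.sum_mul, ← Finset.mul_sum, Finset.sum_const,
      nsmul_eq_mul] at this
    exact this
  have hinv : Tendsto (fun n : ℕ => (n : ℝ)⁻¹) atTop (𝓝 0) := tendsto_inv_atTop_nhds_zero_nat
  have hlim1 : Tendsto (fun n : ℕ => (1 - ε n) * (r * Real.log 2 - T.card * Real.log 2 * (n : ℝ)⁻¹))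
      atTop (𝓝 ((1 - 0) * (r * Real.log 2 - T.card * Real.log 2 * 0))) :=
    (tendsto_const_nhds.sub hε).mul (tendsto_const_nhds.sub (tendsto_const_nhds.mul hinv))
  have hlim2 : Tendsto (fun n : ℕ => 1 / 2 * Real.log (1 + Q) + Real.log 2 * (n : ℝ)⁻¹)
      atTop (𝓝 (1 / 2 * Real.log (1 + Q) + Real.log 2 * 0)) :=
    tendsto_const_nhds.add (tendsto_const_nhds.mul hinv)
  have hle := le_of_tendsto_of_tendsto hlim1 hlim2 (by
    filter_upwards [hε.eventually_lt_const one_pos, eventually_gt_atTop 0] with n hn hn0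
    have hn' : (0 : ℝ) < n := by exact_mod_cast hn0
    have h1 := (mul_le_mul_of_nonneg_left (hlow n) (sub_nonneg.2 hn.le)).trans (hF n)
    have h2 := mul_le_mul_of_nonneg_right h1 (inv_nonneg.2 hn'.le)
    calc _ = (1 - ε n) * (n * r * Real.log 2 - T.card * Real.log 2) * (n : ℝ)⁻¹ := by
          field_simp
      _ ≤ _ := h2
      _ = _ := by field_simp)
  rw [cap, Real.logb, ← mul_div_assoc, le_div_iff₀ hl2]
  linarith

theorem sum_genieLinks_le_downlink {h : Fin 3 → ℝ} {P : ℝ} (hP : 0 ≤ P) {R : Rates}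
    (hR : R ∈ capacityRegion h P) (j l : Fin 3) (hjl : j ≠ l) :
    ∑ p ∈ genieLinks j l, R p ≤ cap ((h j ^ 2 + h l ^ 2) * P) := by
  obtain ⟨hR0, c, hc, hε⟩ := hR
  refine sum_rates_le_cap hR0 _ _ _ hε fun n => ?_
  have := neZero_messageCount hR0 n
  exact (c n).downlink_bound h P hP (hc n) j l hjl

theorem sum_genieLinks_le_uplink {h : Fin 3 → ℝ} {P : ℝ} (hP : 0 ≤ P) {R : Rates}
    (hR : R ∈ capacityRegion h P) (j k l : Fin 3) (hjk : j ≠ k) (hjl : j ≠ l) (hkl : k ≠ l) :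
    ∑ p ∈ genieLinks j l, R p ≤ cap ((|h k| + |h l|) ^ 2 * P) := by
  obtain ⟨hR0, c, hc, hε⟩ := hR
  refine sum_rates_le_cap hR0 _ _ _ hε fun n => ?_
  have := neZero_messageCount hR0 n
  exact (c n).uplink_bound h P hP (hc n) j k l hjk hjl hkl

/-- The two genie triples share the helper user `2` and are complementary: one holds the links `(0,
1)`, `(2, 1)`, `(0, 2)`, the other `(1, 0)`, `(2, 0)`, `(1, 2)`. -/
theorem sumRate_eq_genieLinks (R : Rates) :
    sumRate R = ∑ p ∈ genieLinks 1 2, R p + ∑ p ∈ genieLinks 0 2, R p := by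
  rw [sumRate, ← Finset.sum_add_sum_compl (genieLinks 1 2),
    show (genieLinks 1 2)ᶜ = genieLinks 0 2 by decide]

/-- The genie-aided bound on the sum-capacity. -/
def genieBound (h : Fin 3 → ℝ) (P : ℝ) : ℝ :=
  cap ((h 1 ^ 2 + h 2 ^ 2) * P) + cap (min (h 0 ^ 2 + h 2 ^ 2) ((|h 1| + |h 2|) ^ 2) * P)

theorem sumCapacity_le_genieBound (h : Fin 3 → ℝ) {P : ℝ} (hP : 0 ≤ P) :
    sumCapacity h P ≤ (genieBound h P : EReal) := by
  refine iSup₂_le fun R hR => EReal.coe_le_coe_iff.2 ?_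
  rw [sumRate_eq_genieLinks, genieBound]
  refine add_le_add (sum_genieLinks_le_downlink hP hR 1 2 (by decide)) ?_
  rcases min_choice (h 0 ^ 2 + h 2 ^ 2) ((|h 1| + |h 2|) ^ 2) with h' | h' <;> rw [h']
  · exact sum_genieLinks_le_downlink hP hR 0 2 (by decide)
  · exact sum_genieLinks_le_uplink hP hR 0 1 2 (by decide) (by decide) (by decide)

/-! ### High-power asymptotics and the cut-set bounds -/

theorem cap_mono {x y : ℝ} (hx : 0 ≤ x) (hxy : x ≤ y) : cap x ≤ cap y := by
  unfold cap
  have := Real.logb_le_logb_of_le one_lt_two (by linarith : 0 < 1 + x) (by linarith : 1 + x ≤ 1 + y)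
  linarith

theorem cap_nonneg {x : ℝ} (hx : 0 ≤ x) : 0 ≤ cap x :=
  mul_nonneg (by norm_num) (Real.logb_nonneg one_lt_two (by linarith))

theorem tendsto_cap_div {K : ℝ} (hK : 0 < K) :
    Tendsto (fun P => cap (K * P) / (1 / 2 * Real.logb 2 P)) atTop (𝓝 1) := by
  have h1 : Tendsto (fun P : ℝ => Real.log (P⁻¹ + K)) atTop (𝓝 (Real.log (0 + K))) :=
    (tendsto_inv_atTop_zero.add_const K).log (by simpa using hK.ne')
  have h2 := (h1.div_atTop Real.tendsto_log_atTop).const_add 1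
  rw [add_zero] at h2
  refine h2.congr' ?_
  filter_upwards [eventually_gt_atTop 1] with P hP
  have hl : Real.log P ≠ 0 := (Real.log_pos hP).ne'
  have hl2 : Real.log 2 ≠ 0 := (Real.log_pos one_lt_two).ne'
  have hP0 : (0 : ℝ) < P := by linarith
  have : Real.log (1 + K * P) = Real.log P + Real.log (P⁻¹ + K) := by
    rw [← Real.log_mul hP0.ne' (by positivity)]
    congr 1
    field_simp
  rw [cap, Real.logb, Real.logb, this]
  field_simp

theorem tendsto_cap_atTop {K : ℝ} (hK : 0 < K) : Tendsto (fun P => cap (K * P)) atTop atTop := by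
  unfold cap
  exact ((Real.tendsto_logb_atTop one_lt_two).comp (tendsto_atTop_add_const_left _ 1
    (tendsto_id.const_mul_atTop hK))).const_mul_atTop (by norm_num)

/-- Changing the gain costs a constant independent of `P`, so a surplus of one capacity survives the
comparison of different gains. -/
theorem cap_le_cap_add {K L P : ℝ} (hL : 0 < L) (hLK : L ≤ K) (hP : 0 ≤ P) :
    cap (K * P) ≤ cap (L * P) + 1 / 2 * Real.logb 2 (K / L) := by
  have hK : 0 < K := hL.trans_le hLK
  have h1 : 1 + K * P ≤ (1 + L * P) * (K / L) := by
    have : (1 + L * P) * (K / L) = K / L + K * P := by field_simp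
    rw [this]
    have := (one_le_div hL).2 hLK
    linarith
  have h2 := Real.logb_le_logb_of_le one_lt_two (by positivity) h1
  rw [Real.logb_mul (by positivity) (by positivity)] at h2
  unfold cap
  linarith

/-- The genie-aided bound is at most twice the capacity of a single Gaussian channel. -/
theorem genieBound_le (h : Fin 3 → ℝ) {P : ℝ} (hP : 0 ≤ P) :
    genieBound h P ≤ 2 * cap ((1 + (|h 1| + |h 2|) ^ 2) * P) := by
  have h1 : cap ((h 1 ^ 2 + h 2 ^ 2) * P) ≤ cap ((1 + (|h 1| + |h 2|) ^ 2) * P) := by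
    refine cap_mono (by positivity) (mul_le_mul_of_nonneg_right ?_ hP)
    rw [← sq_abs (h 1), ← sq_abs (h 2)]
    nlinarith [mul_nonneg (abs_nonneg (h 1)) (abs_nonneg (h 2))]
  have h2 : cap (min (h 0 ^ 2 + h 2 ^ 2) ((|h 1| + |h 2|) ^ 2) * P) ≤
      cap ((1 + (|h 1| + |h 2|) ^ 2) * P) :=
    cap_mono (by positivity) (mul_le_mul_of_nonneg_right
      ((min_le_right _ _).trans (by linarith)) hP)
  unfold genieBound
  linarith

theorem limsup_dofRatio_sumCapacity_le (h : Fin 3 → ℝ) :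
    limsup (dofRatio (sumCapacity h)) atTop ≤ 2 := by
  -- The summand `1` keeps the gain positive, so the limit holds even when `h 1` and `h 2` vanish.
  have hlim : Tendsto (fun P => ((2 * (cap ((1 + (|h 1| + |h 2|) ^ 2) * P) /
      (1 / 2 * Real.logb 2 P)) : ℝ) : EReal)) atTop (𝓝 ((2 * 1 : ℝ) : EReal)) :=
    (continuous_coe_real_ereal.tendsto _).comp ((tendsto_cap_div (by positivity)).const_mul 2)
  have hle : dofRatio (sumCapacity h) ≤ᶠ[atTop] fun P =>
      ((2 * (cap ((1 + (|h 1| + |h 2|) ^ 2) * P) / (1 / 2 * Real.logb 2 P)) : ℝ) : EReal) := by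
    filter_upwards [eventually_gt_atTop 1] with P hP
    have hl : 0 < 1 / 2 * Real.logb 2 P := mul_pos (by norm_num) (Real.logb_pos one_lt_two hP)
    rw [← mul_div_assoc, EReal.coe_div]
    refine EReal.div_le_div_right_of_nonneg (EReal.coe_nonneg.2 hl.le) ?_
    exact (sumCapacity_le_genieBound h (by linarith)).trans
      (EReal.coe_le_coe_iff.2 (genieBound_le h (by linarith)))
  refine (limsup_le_limsup hle).trans ?_
  rw [hlim.limsup_eq, mul_one]
  exact le_of_eq rfl

theorem cutSetSumRate_le_cutSetBound (h : Fin 3 → ℝ) {P : ℝ} (hP : 0 ≤ P) :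
    cutSetSumRate h P ≤ (cutSetBound h P : EReal) := by
  refine iSup₂_le fun R hR => EReal.coe_le_coe_iff.2 ?_
  have h0 := (hR.2 0 1 2 (by decide) (by decide) (by decide)).1
  have h1 := (hR.2 1 0 2 (by decide) (by decide) (by decide)).1
  have h2 := (hR.2 2 0 1 (by decide) (by decide) (by decide)).1
  have h1' := h1.trans (cap_mono (by positivity)
    (mul_le_mul_of_nonneg_right (min_le_left _ _) hP))
  have h2' := h2.trans (cap_mono (by positivity)
    (mul_le_mul_of_nonneg_right (min_le_left _ _) hP))
  have hsum : sumRate R = (R ⟨(0, 1), by decide⟩ + R ⟨(0, 2), by decide⟩) +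
      (R ⟨(1, 0), by decide⟩ + R ⟨(1, 2), by decide⟩) +
      (R ⟨(2, 0), by decide⟩ + R ⟨(2, 1), by decide⟩) := by
    rw [sumRate, show (Finset.univ : Finset Link) = {⟨(0, 1), by decide⟩, ⟨(0, 2), by decide⟩,
      ⟨(1, 0), by decide⟩, ⟨(1, 2), by decide⟩, ⟨(2, 0), by decide⟩, ⟨(2, 1), by decide⟩} by decide]
    simp [Finset.sum_insert]
    ring
  rw [hsum, cutSetBound]
  linarith

/-- Equal splitting of the weakest user's capacity satisfies all the cut-set bounds. -/
theorem le_cutSetSumRate (h : Fin 3 → ℝ) (h₁₂ : h 1 ^ 2 ≤ h 0 ^ 2) (h₂₃ : h 2 ^ 2 ≤ h 1 ^ 2)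
    {P : ℝ} (hP : 0 ≤ P) : ((3 * cap (h 2 ^ 2 * P) : ℝ) : EReal) ≤ cutSetSumRate h P := by
  have hmin : ∀ j, h 2 ^ 2 ≤ h j ^ 2 := by
    intro j
    fin_cases j
    exacts [h₂₃.trans h₁₂, h₂₃, le_rfl]
  let R : Rates := fun _ => cap (h 2 ^ 2 * P) / 2
  have hmem : R ∈ cutSetRegion h P := by
    refine ⟨fun _ => div_nonneg (cap_nonneg (by positivity)) (by norm_num),
      fun j k l _ _ _ => ⟨?_, ?_⟩⟩
    · rw [add_halves]
      exact cap_mono (by positivity) (mul_le_mul_of_nonneg_right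
        (le_min (hmin j) ((hmin k).trans (by nlinarith [sq_nonneg (h l)]))) hP)
    · rw [add_halves]
      refine cap_mono (by positivity) (mul_le_mul_of_nonneg_right (le_min ?_ (hmin l)) hP)
      refine (hmin j).trans ?_
      rw [← sq_abs (h j)]
      exact pow_le_pow_left₀ (abs_nonneg _) (by linarith [abs_nonneg (h k)]) 2
  have hsum : sumRate R = 3 * cap (h 2 ^ 2 * P) := by
    have : Fintype.card Link = 6 := by decide
    simp only [sumRate, R, Finset.sum_const, Finset.card_univ, this, nsmul_eq_mul]
    push_cast
    ring
  rw [← hsum]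
  exact le_iSup₂_of_le R hmem le_rfl

theorem hasDoF_cutSetBound (h : Fin 3 → ℝ) (h0 : h 0 ≠ 0) (h1 : h 1 ≠ 0) (h2 : h 2 ≠ 0) :
    HasDoF (fun P => (cutSetBound h P : EReal)) 3 := by
  have hpos : 0 < min (h 0 ^ 2) (h 1 ^ 2 + h 2 ^ 2) := lt_min (by positivity) (by positivity)
  have hlim := ((tendsto_cap_div hpos).add (tendsto_cap_div (K := h 1 ^ 2) (by positivity))).add
    (tendsto_cap_div (K := h 2 ^ 2) (by positivity))
  have := (continuous_coe_real_ereal.tendsto _).comp hlim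
  rw [show ((1 + 1 + 1 : ℝ) : EReal) = 3 by norm_num; rfl] at this
  refine this.congr fun P => ?_
  rw [dofRatio, ← EReal.coe_div, cutSetBound, add_div, add_div]
  rfl

theorem hasDoF_cutSetSumRate (h : Fin 3 → ℝ) (h₁₂ : h 1 ^ 2 ≤ h 0 ^ 2) (h₂₃ : h 2 ^ 2 ≤ h 1 ^ 2)
    (h0 : h 0 ≠ 0) (h1 : h 1 ≠ 0) (h2 : h 2 ≠ 0) : HasDoF (cutSetSumRate h) 3 := by
  have hlow : Tendsto (fun P => ((3 * (cap (h 2 ^ 2 * P) / (1 / 2 * Real.logb 2 P)) : ℝ) : EReal))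
      atTop (𝓝 ((3 * 1 : ℝ) : EReal)) :=
    (continuous_coe_real_ereal.tendsto _).comp ((tendsto_cap_div (by positivity)).const_mul 3)
  rw [show ((3 * 1 : ℝ) : EReal) = 3 by norm_num; rfl] at hlow
  refine tendsto_of_tendsto_of_tendsto_of_le_of_le' hlow (hasDoF_cutSetBound h h0 h1 h2) ?_ ?_
  all_goals
    filter_upwards [eventually_gt_atTop 1] with P hP
    have hl : 0 < 1 / 2 * Real.logb 2 P := mul_pos (by norm_num) (Real.logb_pos one_lt_two hP)
  · rw [← mul_div_assoc, EReal.coe_div]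
    exact EReal.div_le_div_right_of_nonneg (EReal.coe_nonneg.2 hl.le)
      (le_cutSetSumRate h h₁₂ h₂₃ (by linarith))
  · exact EReal.div_le_div_right_of_nonneg (EReal.coe_nonneg.2 hl.le)
      (cutSetSumRate_le_cutSetBound h (by linarith))

/-- Three capacities minus two leave one, up to the constant `logb 2 (K / h 2 ^ 2)`, which is twice
the cost of passing from gain `K` to gain `h 2 ^ 2`. The general `S` covers both forms of the
cut-set bound. -/
theorem tendsto_sub_sumCapacity (h : Fin 3 → ℝ) (h2 : h 2 ≠ 0) (S : ℝ → EReal)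
    (hS : ∀ P, 0 ≤ P → ((3 * cap (h 2 ^ 2 * P) : ℝ) : EReal) ≤ S P) :
    Tendsto (fun P => S P - sumCapacity h P) atTop (𝓝 ⊤) := by
  set K := 1 + (|h 1| + |h 2|) ^ 2 with hK
  have hLK : h 2 ^ 2 ≤ K := by
    rw [hK, ← sq_abs (h 2)]
    nlinarith [abs_nonneg (h 1), abs_nonneg (h 2), mul_nonneg (abs_nonneg (h 1)) (abs_nonneg (h 2))]
  have hL : 0 < h 2 ^ 2 := by positivity
  have hlim : Tendsto (fun P => cap (h 2 ^ 2 * P) + -Real.logb 2 (K / h 2 ^ 2)) atTop atTop :=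
    tendsto_atTop_add_const_right _ _ (tendsto_cap_atTop hL)
  refine tendsto_nhds_top_mono (EReal.tendsto_coe_nhds_top_iff.2 hlim) ?_
  filter_upwards [eventually_ge_atTop 0] with P hP
  have h1 := genieBound_le h hP
  have h3 := cap_le_cap_add hL hLK hP
  calc _ ≤ ((3 * cap (h 2 ^ 2 * P) - genieBound h P : ℝ) : EReal) :=
        EReal.coe_le_coe_iff.2 (by linarith)
    _ = ((3 * cap (h 2 ^ 2 * P) : ℝ) : EReal) - (genieBound h P : EReal) := EReal.coe_sub _ _
    _ ≤ _ := EReal.sub_le_sub (hS P hP) (sumCapacity_le_genieBound h hP)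

end YChannel

end

theorem mainTheorem3 (h : Fin 3 → ℝ) (h₁₂ : h 1 ^ 2 ≤ h 0 ^ 2) (h₂₃ : h 2 ^ 2 ≤ h 1 ^ 2) :
    (∀ P : ℝ, 0 ≤ P →
      YChannel.sumCapacity h P ≤
        ((YChannel.cap ((h 1 ^ 2 + h 2 ^ 2) * P) +
          YChannel.cap (min (h 0 ^ 2 + h 2 ^ 2) ((|h 1| + |h 2|) ^ 2) * P) : ℝ) : EReal)) ∧
    Filter.limsup (YChannel.dofRatio (YChannel.sumCapacity h)) Filter.atTop ≤ 2 ∧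
    (∀ d : EReal, YChannel.HasDoF (YChannel.sumCapacity h) d → d ≤ 2) ∧
    (h 2 ≠ 0 →
      YChannel.HasDoF (YChannel.cutSetSumRate h) 3 ∧
      YChannel.HasDoF (fun P => (YChannel.cutSetBound h P : EReal)) 3 ∧
      Filter.Tendsto (fun P => YChannel.cutSetSumRate h P - YChannel.sumCapacity h P)
        Filter.atTop (nhds ⊤) ∧
      Filter.Tendsto (fun P => (YChannel.cutSetBound h P : EReal) - YChannel.sumCapacity h P)
        Filter.atTop (nhds ⊤)) := by
  have hlimsup := YChannel.limsup_dofRatio_sumCapacity_le h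
  refine ⟨fun P hP => YChannel.sumCapacity_le_genieBound h hP, hlimsup,
    fun d hd => hd.limsup_eq ▸ hlimsup, fun h2 => ?_⟩
  have hlow := fun P hP => YChannel.le_cutSetSumRate h h₁₂ h₂₃ (P := P) hP
  have hpos : 0 < h 2 ^ 2 := by positivity
  have h1 : h 1 ≠ 0 := fun h' => by simp [h'] at h₂₃; exact h2 h₂₃
  have h0 : h 0 ≠ 0 := fun h' => by simp [h'] at h₁₂; exact h1 h₁₂
  exact ⟨YChannel.hasDoF_cutSetSumRate h h₁₂ h₂₃ h0 h1 h2, YChannel.hasDoF_cutSetBound h h0 h1 h2,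
    YChannel.tendsto_sub_sumCapacity h h2 _ hlow,
    YChannel.tendsto_sub_sumCapacity h h2 _ fun P hP =>
      (hlow P hP).trans (YChannel.cutSetSumRate_le_cutSetBound h hP)⟩
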